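/- Work in the comparison model. A dynamic array initially consists of $n$ elements of a totally ordered universe (equal elements are allowed), given as an unsorted array $A$. Its current contents are denoted $A'$. It undergoes a sequence of $q$ operations that arrive online: each has to be answered before the next one is known, and elements are accessible only through comparisons $x\le y$. The operations are: $\mathrm{select}(i)$, which returns the $i$-th smallest element of $A'$; $\mathrm{search}(a)$, which reports whether $a$ occurs in $A'$ and returns the position of $a$ in sorted order (the first one, if $a$ occurs several times), or the number of elements of $A'$ smaller than $a$ if $a$ does not occur; $\mathrm{insert}(a)$, which adds $a$ to $A'$; and $\mathrm{delete}(i)$, which removes the $i$-th smallest entry of $A'$. Here $1\le i\le |A'|$, and every operation $\mathrm{insert}(a)$ is immediately preceded by the operation $\mathrm{search}(a)$. Each selection and each search has a position in the sorted original array: for a selection that hits an original entry, the rank of this entry among the $n$ original entries; for $\mathrm{search}(a)$, and for a selection that hits an inserted entry $a$, the first rank of $a$ in the sorted original array if $a$ occurs in it, and otherwise the number of original elements smaller than $a$. (In the sorted order of $A'$, equal original entries keep a fixed order, and a newly inserted entry precedes the entries equal to it.) Let $S_q=(s_1\le\dots\le s_m)$ be the sorted positions of all selections and searches, put $s_0=0$,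 $s_{m+1}=n$, $\Delta_i=s_{i+1}-s_i$, and $$\mathcal B(S_q)=\log_2 n!-\sum_{i=0}^{m}\log_2(\Delta_i!).$$ Theorem (Optimal Online Dynamic Multiselection). There is a deterministic online data structure that answers every such sequence of operations correctly, and there is a function $\delta:\mathbb R\to\mathbb R$, bounded above, with $\delta(x)\to 0$ as $x\to\infty$, such that for every constant $C$ there is a constant $K$ with the following property. For every $n$, every array of $n$ elements and every such sequence of $q\le Cn$ operations, of which $q'$ are searches, insertions or deletions, the total number of comparisons (preprocessing included) is at most $$\mathcal B(S_q)\bigl(1+\delta(\mathcal B(S_q)/n)\bigr)+K\,(n+q'\log_2 n),$$ that is, $\mathcal B(S_q)(1+o(1))+O(n+q'\log n)$ where the $o(1)$ refers to $\mathcal B(S_q)/n\to\infty$. -/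

import Mathlib

namespace DynMultiselect

/-! ### The comparison model -/

/-- A deterministic procedure that learns about the elements only through comparisons.  Elements
are addressed by their index in the memory; `cmp i j yes no` asks whether `element i ≤ element j`
and continues with `yes` or `no`; `ret r` stops with result `r`. -/
inductive CompTree (R : Type) : Type
  | ret (r : R) : CompTree R
  | cmp (i j : ℕ) (yes no : CompTree R) : CompTree R

/-- The outcome of the comparison `mem[i] ≤ mem[j]`.  A comparison that involves an address
holding no element always comes out `false`, so it gives no information. -/
def leAt {α : Type*} [LinearOrder α] (mem : List α) (i j : ℕ) : Bool :=
  match mem[i]?, mem[j]? with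
  | some x, some y => decide (x ≤ y)
  | _, _ => false

/-- The result of a procedure on the given memory. -/
def CompTree.eval {R : Type} {α : Type*} [LinearOrder α] (mem : List α) : CompTree R → R
  | .ret r => r
  | .cmp i j yes no => if leAt mem i j then yes.eval mem else no.eval mem

/-- The number of comparisons that a procedure makes on the given memory. -/
def CompTree.cost {R : Type} {α : Type*} [LinearOrder α] (mem : List α) : CompTree R → ℕ
  | .ret _ => 0
  | .cmp i j yes no => 1 + if leAt mem i j then yes.cost mem else no.cost mem

/-- The operations on a dynamic array over the universe `α`; ranks `i` count from `1`. -/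
inductive Op (α : Type*)
  | select (i : ℕ)
  | search (a : α)
  | insert (a : α)
  | delete (i : ℕ)

/-- The answers: the element returned by a selection (`none` for an invalid address), the outcome
of a search (whether the element is present, and its position), no answer for an update. -/
inductive Answer (α : Type*)
  | element (x : Option α)
  | position (found : Bool) (j : ℕ)
  | done

/-- A deterministic online data structure in the comparison model.  The memory first holds the `n`
original elements at the addresses `0, …, n - 1`; the argument of every `search` and `insert` is
appended to it when that operation arrives.  The data structure sees the kind of the current
operation, the rank argument of `select` and `delete`, and its own state, which depends only on the
past; the elements are accessible to it only through comparisons. -/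
structure OnlineStructure where
  /-- internal states -/
  State : Type
  /-- preprocessing of an array with `n` elements -/
  init : (n : ℕ) → CompTree State
  /-- new state, and the address of the selected element -/
  select : State → (i : ℕ) → CompTree (State × ℕ)
  /-- new state, whether the element is present, and its position -/
  search : State → CompTree (State × Bool × ℕ)
  /-- new state -/
  insert : State → CompTree State
  /-- new state -/
  delete : State → (i : ℕ) → CompTree State

/-- The effect of a single operation. -/
structure StepResult (σ : Type) (α : Type*) where
  state : σ
  mem : List α
  answer : Answer α
  cost : ℕ

namespace OnlineStructure

/-- Execution of one operation. -/
def step (D : OnlineStructure) {α : Type*} [LinearOrder α] (s : D.State) (mem : List α) :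
    Op α → StepResult D.State α
  | .select i =>
      let t := D.select s i
      ⟨(t.eval mem).1, mem, .element mem[(t.eval mem).2]?, t.cost mem⟩
  | .search a =>
      let t := D.search s
      let mem' := mem ++ [a]
      ⟨(t.eval mem').1, mem', .position (t.eval mem').2.1 (t.eval mem').2.2, t.cost mem'⟩
  | .insert a =>
      let t := D.insert s
      let mem' := mem ++ [a]
      ⟨t.eval mem', mem', .done, t.cost mem'⟩
  | .delete i =>
      let t := D.delete s i
      ⟨t.eval mem, mem, .done, t.cost mem⟩

/-- The answers given to a sequence of operations, starting from a state and a memory. -/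
def answersFrom (D : OnlineStructure) {α : Type*} [LinearOrder α] :
    D.State → List α → List (Op α) → List (Answer α)
  | _, _, [] => []
  | s, mem, o :: os =>
      (D.step s mem o).answer :: D.answersFrom (D.step s mem o).state (D.step s mem o).mem os

/-- The number of comparisons made for a sequence of operations, starting from a state and a
memory. -/
def costFrom (D : OnlineStructure) {α : Type*} [LinearOrder α] :
    D.State → List α → List (Op α) → ℕ
  | _, _, [] => 0
  | s, mem, o :: os =>
      (D.step s mem o).cost + D.costFrom (D.step s mem o).state (D.step s mem o).mem os

/-- The answers given to the operations `ops` on the original array `A`. -/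
def answers (D : OnlineStructure) {α : Type*} [LinearOrder α] (A : List α) (ops : List (Op α)) :
    List (Answer α) :=
  D.answersFrom ((D.init A.length).eval A) A ops

/-- The total number of comparisons, preprocessing included. -/
def cost (D : OnlineStructure) {α : Type*} [LinearOrder α] (A : List α) (ops : List (Op α)) : ℕ :=
  (D.init A.length).cost A + D.costFrom ((D.init A.length).eval A) A ops

end OnlineStructure

/-! ### The intended behaviour -/

/-- The position reported by a search for `p` among the elements of `l`: if `p` occurs in `l`, the
(first, counting from `1`) position of `p` in sorted order, otherwise the number of elements
smaller than `p`. -/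
def searchPos {α : Type*} [LinearOrder α] (l : List α) (p : α) : ℕ :=
  l.countP (fun x => decide (x < p)) + if p ∈ l then 1 else 0

/-- An entry of the current array together with its position in the sorted original array. -/
structure Entry (α : Type*) where
  value : α
  pos : ℕ

/-- The original array in sorted order; its entries have the positions `1, …, n`. -/
def initEntries {α : Type*} [LinearOrder α] (A : List α) : List (Entry α) :=
  ((A.insertionSort (· ≤ ·)).zipIdx 1).map fun x => ⟨x.1, x.2⟩

/-- The effect of an operation on the current array in sorted order.  A new element is put before
the first entry that is not smaller; its position is the one that a search for it in the original
array `A` reports. -/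
def applyOp {α : Type*} [LinearOrder α] (A : List α) (L : List (Entry α)) :
    Op α → List (Entry α)
  | .select _ => L
  | .search _ => L
  | .insert a =>
      L.takeWhile (fun e => decide (e.value < a)) ++
        ⟨a, searchPos A a⟩ :: L.dropWhile (fun e => decide (e.value < a))
  | .delete i => L.eraseIdx (i - 1)

/-- The correct answer to an operation when the current array in sorted order is `L`. -/
def expectedAnswer {α : Type*} [LinearOrder α] (L : List (Entry α)) : Op α → Answer α
  | .select i => .element ((L.map Entry.value)[i - 1]?)
  | .search a => .position (decide (a ∈ L.map Entry.value)) (searchPos (L.map Entry.value) a)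
  | .insert _ => .done
  | .delete _ => .done

/-- The correct answers to a sequence of operations, starting from the current array `L`. -/
def expectedFrom {α : Type*} [LinearOrder α] (A : List α) :
    List (Entry α) → List (Op α) → List (Answer α)
  | _, [] => []
  | L, o :: os => expectedAnswer L o :: expectedFrom A (applyOp A L o) os

/-- The correct answers to the operations `ops` on the original array `A`. -/
def expectedAnswers {α : Type*} [LinearOrder α] (A : List α) (ops : List (Op α)) :
    List (Answer α) :=
  expectedFrom A (initEntries A) ops

/-- An operation is admissible when its rank lies in the current array; an insertion has to follow
immediately after a search for the same element. -/
def Admissible {α : Type*} (prev : Option (Op α)) (L : List (Entry α)) : Op α → Prop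
  | .select i => 1 ≤ i ∧ i ≤ L.length
  | .search _ => True
  | .insert a => prev = some (.search a)
  | .delete i => 1 ≤ i ∧ i ≤ L.length

/-- Admissibility of a sequence of operations, given the previous operation and the current
array. -/
def ValidFrom {α : Type*} [LinearOrder α] (A : List α) :
    Option (Op α) → List (Entry α) → List (Op α) → Prop
  | _, _, [] => True
  | prev, L, o :: os => Admissible prev L o ∧ ValidFrom A (some o) (applyOp A L o) os

/-- Admissibility of a sequence of operations on the original array `A`. -/
def Valid {α : Type*} [LinearOrder α] (A : List α) (ops : List (Op α)) : Prop :=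
  ValidFrom A none (initEntries A) ops

/-! ### The information-theoretic bound -/

/-- The position in the sorted original array that an operation queries: the position of the
selected entry, or the position that a search in the original array reports.  Updates query
nothing. -/
def queryPos {α : Type*} [LinearOrder α] (A : List α) (L : List (Entry α)) : Op α → List ℕ
  | .select i => (L[i - 1]?).toList.map Entry.pos
  | .search a => [searchPos A a]
  | .insert _ => []
  | .delete _ => []

/-- The positions queried by a sequence of operations, starting from the current array `L`. -/
def queriesFrom {α : Type*} [LinearOrder α] (A : List α) :
    List (Entry α) → List (Op α) → List ℕ
  | _, [] => []
  | L, o :: os => queryPos A L o ++ queriesFrom A (applyOp A L o) os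

/-- The positions in the sorted original array queried by `ops`, in order of arrival. -/
def queries {α : Type*} [LinearOrder α] (A : List α) (ops : List (Op α)) : List ℕ :=
  queriesFrom A (initEntries A) ops

/-- The gaps `s (i + 1) - s i` between the sorted positions, where `s 0 = 0` and the last one
is `n`. -/
def gaps (n : ℕ) (S : List ℕ) : List ℕ :=
  List.zipWith (fun a b => b - a)
    (0 :: S.insertionSort (· ≤ ·)) (S.insertionSort (· ≤ ·) ++ [n])

/-- The information-theoretic bound `log n! - ∑ i, log (Δ i)!`, with logarithms to base two. -/
noncomputable def infoBound (n : ℕ) (S : List ℕ) : ℝ :=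
  Real.logb 2 (n.factorial : ℝ) -
    ((gaps n S).map fun d => Real.logb 2 (d.factorial : ℝ)).sum

/-- Whether an operation is a search, an insertion or a deletion. -/
def Op.nonSelect {α : Type*} : Op α → Bool
  | .select _ => false
  | _ => true

end DynMultiselect

universe u

open DynMultiselect

/-! The structure is a lazy sample sort. The original addresses are kept in an ordered partition
into buckets, and a query refines only the bucket that contains the queried rank, repeatedly, until
that rank lies in a singleton. A bucket of level `j` has at most `n / 2 ^ depth j` elements if it is
not a singleton, where `depth j = 1 + ... + j`. Splitting it by the factor `2 ^ (j + 1)` costs `j +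
1 + O(1)` comparisons per element (`spec_expand`). The branching grows with the level so that the
`O(1)` overhead becomes negligible against the `j + 1` bits gained; a fixed branching would spoil
the leading constant. Since `depth` is quadratic, an element of level `j` has paid `weight j`, which
exceeds `depth (j - 1)` only by a term of the order of its square root, plus a constant.

Lower bounds do not enter; the cost is compared with the information bound directly. An element of
rank `k + 1` and level `j + 1` lay in a bucket of level `j` that was refined for some position `s`,
so `|k + 1 - s| * 2 ^ depth j ≤ n` (`Partition.expand`). Hence `depth j` is at most `log (n /
distance to the nearest refined position)`. Over a gap of length `Δ`, the distances to the two ends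
have product at least `Δ!` up to a factor `2 ^ O(Δ)` (`sum_le_of_gap`), so the sum `Y` of these
depths is at most `B + O(n)` (`sum_le_infoBound`). By Cauchy-Schwarz the square-root terms add up to
`O(√(n Y))`, which is `o(B)` as `B / n` tends to infinity (`add_sqrt_le_excess`).

Everything else costs `O(n)` or `O(log n)` per search. A selection finds its bucket from the bucket
sizes, without comparisons. A search makes binary searches over bucket minima along a path of
buckets, `O(log n)` in all because `pathWeight` and `depth` are both quadratic, and binary searches
among the inserted elements. An insertion reuses the rank found by the preceding search, and a
deletion only edits the list of entries.

With equal elements a search needs both the number of smaller elements and the number of elements at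
most `a`, so it may also refine at the last occurrence of `a`, which need not be a queried position.
Each gap contains at most one such extra point, and splitting a gap at one point changes the bound
only by `O(Δ)` (`sum_le_of_split_gap`). -/

namespace DynMultiselect

/-! ### Composition of comparison procedures -/

namespace CompTree

/-- Run a procedure and continue with its result. -/
def bind {R S : Type} : CompTree R → (R → CompTree S) → CompTree S
  | .ret r, f => f r
  | .cmp i j yes no, f => .cmp i j (yes.bind f) (no.bind f)

/-- A single comparison. -/
def ask (i j : ℕ) : CompTree Bool := .cmp i j (.ret true) (.ret false)

/-- The result and the cost of a procedure on a memory satisfy `Q`. -/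
def Spec {R : Type} {α : Type*} [LinearOrder α] (mem : List α) (t : CompTree R)
    (Q : R → ℕ → Prop) : Prop :=
  Q (t.eval mem) (t.cost mem)

variable {R S : Type} {α : Type*} [LinearOrder α] {mem : List α}

theorem eval_bind (t : CompTree R) (f : R → CompTree S) :
    (t.bind f).eval mem = (f (t.eval mem)).eval mem := by
  induction t with
  | ret r => rfl
  | cmp i j y n hy hn =>
    simp only [bind, eval]
    split <;> assumption

theorem cost_bind (t : CompTree R) (f : R → CompTree S) :
    (t.bind f).cost mem = t.cost mem + (f (t.eval mem)).cost mem := by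
  induction t with
  | ret r => simp [bind, eval, cost]
  | cmp i j y n hy hn =>
    simp only [bind, eval, cost]
    split <;> omega

theorem Spec.bind {t : CompTree R} {f : R → CompTree S} {P : R → ℕ → Prop} {Q : S → ℕ → Prop}
    (h : Spec mem t P) (hf : ∀ r c, P r c → Spec mem (f r) fun s d => Q s (c + d)) :
    Spec mem (t.bind f) Q := by
  unfold Spec
  rw [eval_bind, cost_bind]
  exact hf _ _ h

theorem Spec.mono {t : CompTree R} {P Q : R → ℕ → Prop} (h : Spec mem t P)
    (hPQ : ∀ r c, P r c → Q r c) : Spec mem t Q :=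
  hPQ _ _ h

theorem Spec.ret {r : R} {Q : R → ℕ → Prop} (h : Q r 0) : Spec mem (.ret r) Q := h

theorem spec_ask (i j : ℕ) : Spec mem (ask i j) fun b c => b = leAt mem i j ∧ c = 1 := by
  unfold Spec ask
  simp only [eval, cost]
  cases leAt mem i j <;> simp

end CompTree

open CompTree

/-- Comparisons of addresses below `n` are comparisons of the values `v`. -/
def Models {α β : Type*} [LinearOrder α] [LinearOrder β] (mem : List α) (n : ℕ) (v : ℕ → β) :
    Prop :=
  ∀ i < n, ∀ j < n, leAt mem i j = decide (v i ≤ v j)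

/-! ### Binary search -/

/-- Binary search for the number of elements of a list that pass a test, where those that pass come
first. -/
def bsearch (test : ℕ → CompTree Bool) : ℕ → List ℕ → CompTree ℕ
  | 0, _ => .ret 0
  | f + 1, l =>
    match l.drop (l.length / 2) with
    | [] => .ret 0
    | x :: right => (test x).bind fun b =>
        if b then (bsearch test f right).bind fun k => .ret (l.length / 2 + 1 + k)
        else bsearch test f (l.take (l.length / 2))

section

variable {α β : Type*} [LinearOrder α] [LinearOrder β] {mem : List α} {n : ℕ} {v : ℕ → β}

/-- The fuel doubles as the cost bound: after a probe at index `l.length / 2`, either side has at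
most `l.length / 2 < 2 ^ (f - 1)` elements. -/
theorem spec_bsearch {test : ℕ → CompTree Bool} {p : ℕ → Bool} (f : ℕ) (l : List ℕ)
    (ht : ∀ x ∈ l, Spec mem (test x) fun b c => b = p x ∧ c ≤ 1)
    (hl : l.Pairwise fun x y => p y = true → p x = true) (hf : l.length < 2 ^ f) :
    Spec mem (bsearch test f l) fun k c => k = l.countP p ∧ c ≤ f := by
  induction f generalizing l with
  | zero =>
    have : l = [] := by simpa using hf
    subst this
    exact Spec.ret (by simp)
  | succ f ih =>
    have hsplit := List.take_append_drop (l.length / 2) l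
    have htl : (l.take (l.length / 2)).length = l.length / 2 := by
      rw [List.length_take]; omega
    have hdl : (l.drop (l.length / 2)).length = l.length - l.length / 2 := by simp
    unfold bsearch
    split
    · rename_i h
      rw [h] at hdl
      have : l = [] := by
        rw [← List.length_eq_zero_iff]
        simp at hdl; omega
      subst this
      exact Spec.ret (by simp)
    · rename_i x right h
      rw [h] at hsplit hdl
      generalize l.take (l.length / 2) = left at *
      have hm : ∀ y, y ∈ left ∨ y = x ∨ y ∈ right → y ∈ l := by
        intro y hy; rw [← hsplit]; simpa using hy
      have hp := hl
      rw [← hsplit, List.pairwise_append, List.pairwise_cons] at hp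
      have hc : l.countP p = left.countP p + (if p x then 1 else 0) + right.countP p := by
        rw [← hsplit, List.countP_append, List.countP_cons]; omega
      simp only [List.length_cons] at hdl
      rw [pow_succ] at hf
      refine (ht x (hm x (by simp))).bind ?_
      rintro b c ⟨rfl, hc1⟩
      split
      · rename_i hx
        refine (ih right (fun y hy => ht y (hm y (by simp [hy]))) hp.2.1.2 (by omega)).bind ?_
        rintro k d ⟨rfl, hd⟩
        refine Spec.ret ⟨?_, by omega⟩
        have : left.countP p = left.length :=
          List.countP_eq_length.2 fun y hy => hp.2.2 y hy x (by simp) hx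
        rw [hc, this, hx, htl]; simp
      · rename_i hx
        refine (ih left (fun y hy => ht y (hm y (by simp [hy]))) hp.1 (by omega)).mono ?_
        rintro k d ⟨rfl, hd⟩
        refine ⟨?_, by omega⟩
        have : right.countP p = 0 :=
          List.countP_eq_zero.2 fun y hy hpy => hx (hp.2.1.1 y hy hpy)
        rw [hc, this]; simp [hx]

/-! ### Minima, sorting, and linear selection -/

/-- The first element of the list has the least value. -/
def HeadMin (v : ℕ → β) (l : List ℕ) : Prop :=
  ∀ x ∈ l.head?, ∀ y ∈ l, v x ≤ v y

/-- All values of the first list are at most those of the second one. -/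
def Below (v : ℕ → β) (l₁ l₂ : List ℕ) : Prop :=
  ∀ x ∈ l₁, ∀ y ∈ l₂, v x ≤ v y

end

/-- Move an element with the least value to the front. -/
def moveMin : List ℕ → CompTree (List ℕ)
  | [] => .ret []
  | x :: l => (moveMin l).bind fun
    | [] => .ret [x]
    | y :: t => (ask x y).bind fun b => if b then .ret (x :: y :: t) else .ret (y :: x :: t)

/-- Insert an element into a sorted list. -/
def insertSorted (x : ℕ) : List ℕ → CompTree (List ℕ)
  | [] => .ret [x]
  | y :: l => (ask x y).bind fun b =>
      if b then .ret (x :: y :: l) else (insertSorted x l).bind fun l' => .ret (y :: l')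

/-- Insertion sort. -/
def sortList : List ℕ → CompTree (List ℕ)
  | [] => .ret []
  | x :: l => (sortList l).bind fun l' => insertSorted x l'

/-- The medians of successive groups of five elements. -/
def medians : List ℕ → CompTree (List ℕ)
  | a :: b :: c :: d :: e :: l => (sortList [a, b, c, d, e]).bind fun s =>
      (medians l).bind fun m => .ret (s.getD 2 a :: m)
  | _ => .ret []

/-- Distribute a list into the elements smaller than, equal to, and larger than the pivot. -/
def partitionAt (p : ℕ) : List ℕ → CompTree (List ℕ × List ℕ × List ℕ)
  | [] => .ret ([], [], [])
  | x :: l => (partitionAt p l).bind fun s => (ask x p).bind fun b =>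
      if b then (ask p x).bind fun b' =>
        if b' then .ret (s.1, x :: s.2.1, s.2.2) else .ret (x :: s.1, s.2.1, s.2.2)
      else .ret (s.1, s.2.1, x :: s.2.2)

/-- Separate the `k` smallest elements of a list from the others, by medians of medians; the first
argument bounds the depth of the recursion. -/
def splitSmallest : ℕ → List ℕ → ℕ → CompTree (List ℕ × List ℕ)
  | 0, l, k => .ret (l.take k, l.drop k)
  | f + 1, l, k =>
    if l.length ≤ 40 then (sortList l).bind fun s => .ret (s.take k, s.drop k)
    else (medians l).bind fun m => (splitSmallest f m (m.length / 2)).bind fun m' =>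
      (moveMin m'.2).bind fun h => (partitionAt (h.headD 0) l).bind fun s =>
        if k ≤ s.1.length then
          (splitSmallest f s.1 k).bind fun r => .ret (r.1, r.2 ++ (s.2.1 ++ s.2.2))
        else if k ≤ s.1.length + s.2.1.length then
          .ret (s.1 ++ s.2.1.take (k - s.1.length), s.2.1.drop (k - s.1.length) ++ s.2.2)
        else (splitSmallest f s.2.2 (k - s.1.length - s.2.1.length)).bind fun r =>
          .ret (s.1 ++ s.2.1 ++ r.1, r.2)

section

variable {α β : Type*} [LinearOrder α] [LinearOrder β] {mem : List α} {n : ℕ} {v : ℕ → β}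

theorem Models.ask (hv : Models mem n v) {i j : ℕ} (hi : i < n) (hj : j < n) :
    Spec mem (ask i j) fun b c => b = decide (v i ≤ v j) ∧ c = 1 := by
  rw [← hv i hi j hj]
  exact spec_ask i j

theorem spec_moveMin (hv : Models mem n v) (l : List ℕ) (hl : ∀ x ∈ l, x < n) :
    Spec mem (moveMin l) fun l' c => l'.Perm l ∧ HeadMin v l' ∧ c ≤ l.length := by
  induction l with
  | nil => exact Spec.ret ⟨.refl _, by simp [HeadMin], le_rfl⟩
  | cons x l ih =>
    refine (ih fun y hy => hl y (by simp [hy])).bind ?_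
    rintro l' c ⟨hp, hm, hc⟩
    rcases l' with _ | ⟨y, t⟩
    · exact Spec.ret ⟨by simpa using hp, by simp [HeadMin], by simp; omega⟩
    have hy : y ∈ l := hp.subset (by simp)
    simp only [HeadMin, List.head?_cons, Option.mem_def, Option.some.injEq, forall_eq'] at hm
    refine (hv.ask (hl x (by simp)) (hl y (by simp [hy]))).bind ?_
    rintro b c' ⟨rfl, rfl⟩
    split
    · rename_i h
      have h : v x ≤ v y := by simpa using h
      refine Spec.ret ⟨hp.cons x, ?_, by simp; omega⟩
      simp only [HeadMin, List.head?_cons, Option.mem_def, Option.some.injEq, forall_eq']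
      intro z hz
      rcases List.mem_cons.1 hz with rfl | hz
      · exact le_rfl
      · exact h.trans (hm z hz)
    · rename_i h
      have h : v y < v x := by simpa using h
      refine Spec.ret ⟨(List.Perm.swap _ _ _).trans (hp.cons x), ?_, by simp; omega⟩
      simp only [HeadMin, List.head?_cons, Option.mem_def, Option.some.injEq, forall_eq']
      intro z hz
      simp only [List.mem_cons] at hz
      rcases hz with rfl | rfl | hz
      · exact le_rfl
      · exact h.le
      · exact hm z (by simp [hz])

theorem spec_insertSorted (hv : Models mem n v) {x : ℕ} (hx : x < n) (l : List ℕ)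
    (hl : ∀ x ∈ l, x < n) (hs : l.Pairwise fun x y => v x ≤ v y) :
    Spec mem (insertSorted x l) fun l' c =>
      l'.Perm (x :: l) ∧ (l'.Pairwise fun x y => v x ≤ v y) ∧ c ≤ l.length := by
  induction l with
  | nil => exact Spec.ret ⟨.refl _, by simp, le_rfl⟩
  | cons y l ih =>
    rw [List.pairwise_cons] at hs
    refine (hv.ask hx (hl y (by simp))).bind ?_
    rintro b c ⟨rfl, rfl⟩
    split
    · rename_i h
      have h : v x ≤ v y := by simpa using h
      refine Spec.ret ⟨.refl _, ?_, by simp⟩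
      refine List.pairwise_cons.2 ⟨?_, List.pairwise_cons.2 hs⟩
      intro z hz
      rcases List.mem_cons.1 hz with rfl | hz
      · exact h
      · exact h.trans (hs.1 z hz)
    · rename_i h
      have h : v y < v x := by simpa using h
      refine (ih (fun y hy => hl y (by simp [hy])) hs.2).bind ?_
      rintro l' c ⟨hp, hs', hc⟩
      refine Spec.ret ⟨(hp.cons y).trans (.swap _ _ _), ?_, by simp; omega⟩
      refine List.pairwise_cons.2 ⟨?_, hs'⟩
      intro z hz
      rcases List.mem_cons.1 (hp.subset hz) with rfl | hz
      · exact h.le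
      · exact hs.1 z hz

theorem spec_sortList (hv : Models mem n v) (l : List ℕ) (hl : ∀ x ∈ l, x < n) :
    Spec mem (sortList l) fun l' c =>
      l'.Perm l ∧ (l'.Pairwise fun x y => v x ≤ v y) ∧ c ≤ l.length * l.length := by
  induction l with
  | nil => exact Spec.ret ⟨.refl _, by simp, by simp⟩
  | cons x l ih =>
    refine (ih fun y hy => hl y (by simp [hy])).bind ?_
    rintro l' c ⟨hp, hs, hc⟩
    refine (spec_insertSorted hv (hl x (by simp)) l'
      (fun y hy => hl y (by simp [hp.subset hy])) hs).mono ?_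
    rintro l'' c' ⟨hp', hs', hc'⟩
    refine ⟨hp'.trans (hp.cons x), hs', ?_⟩
    rw [hp.length_eq] at hc'
    simp only [List.length_cons]
    nlinarith

/-- If the median of five elements lies in a downward closed set, so do the two elements sorted
before it; likewise upwards. Fewer than five leftover elements are dropped. Arbitrary closed sets
are allowed because the pivot is chosen later. -/
theorem spec_medians (hv : Models mem n v) (l : List ℕ) (hl : ∀ x ∈ l, x < n) :
    Spec mem (medians l) fun m c => m.length = l.length / 5 ∧ (∀ x ∈ m, x ∈ l) ∧
      c ≤ 5 * l.length ∧
      (∀ P : ℕ → Bool, (∀ x y, v x ≤ v y → P y = true → P x = true) →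
        3 * m.countP P ≤ l.countP P) ∧
      (∀ P : ℕ → Bool, (∀ x y, v x ≤ v y → P x = true → P y = true) →
        3 * m.countP P ≤ l.countP P) := by
  induction l using medians.induct with
  | case2 l h =>
    have : l.length < 5 := by
      by_contra hlen
      rcases l with _ | ⟨a, _ | ⟨b, _ | ⟨c, _ | ⟨d, _ | ⟨e, l⟩⟩⟩⟩⟩ <;> simp at hlen
      exact h a b c d e l rfl
    have h2 : medians l = .ret [] := by
      unfold medians
      split
      · exact absurd rfl (h _ _ _ _ _ _)
      · rfl
    rw [h2]
    exact Spec.ret ⟨by simp; omega, by simp, by simp, by simp, by simp⟩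
  | case1 a b c d e l ih =>
    unfold medians
    refine (spec_sortList hv [a, b, c, d, e] fun x hx => hl x ?_).bind ?_
    · simp only [List.mem_cons, List.not_mem_nil, or_false] at hx ⊢; tauto
    rintro s c₁ ⟨hp, hs, hc₁⟩
    refine (ih fun x hx => hl x (by simp [hx])).bind ?_
    rintro m c₂ ⟨hlen, hmem, hc₂, hdown, hup⟩
    obtain ⟨a', b', c', d', e', rfl⟩ : ∃ a' b' c' d' e', s = [a', b', c', d', e'] := by
      have := hp.length_eq
      rcases s with _ | ⟨a, _ | ⟨b, _ | ⟨c, _ | ⟨d, _ | ⟨e, _ | ⟨f, l⟩⟩⟩⟩⟩⟩ <;> simp at this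
      exact ⟨_, _, _, _, _, rfl⟩
    have hcount : ∀ P : ℕ → Bool, (a :: b :: c :: d :: e :: l).countP P =
        [a', b', c', d', e'].countP P + l.countP P := by
      intro P
      rw [hp.countP_eq]
      simp only [← List.countP_append]; rfl
    simp only [List.pairwise_cons, List.mem_cons, forall_eq_or_imp, List.not_mem_nil] at hs
    refine Spec.ret ⟨?_, ?_, ?_, ?_, ?_⟩
    · simp [hlen]; omega
    · intro x hx
      rcases List.mem_cons.1 hx with rfl | hx
      · have : x ∈ [a, b, c, d, e] := hp.subset (by simp)
        simp only [List.mem_cons, List.not_mem_nil, or_false] at this ⊢; tauto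
      · simp [hmem x hx]
    · simp at hc₁ ⊢; omega
    · intro P hP
      rw [hcount]
      have := hdown P hP
      have h1 := hP a' c' hs.1.2.1
      have h2 := hP b' c' hs.2.1.1
      simp only [List.getD_cons_succ, List.getD_cons_zero, List.countP_cons, List.countP_nil]
      by_cases h : P c' = true
      · simp only [h, h1 h, h2 h, if_true]; omega
      · simp only [h]; simp; omega
    · intro P hP
      rw [hcount]
      have := hup P hP
      have h1 := hP c' d' hs.2.2.1.1
      have h2 := hP c' e' hs.2.2.1.2.1
      simp only [List.getD_cons_succ, List.getD_cons_zero, List.countP_cons, List.countP_nil]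
      by_cases h : P c' = true
      · simp only [h, h1 h, h2 h, if_true]; omega
      · simp only [h]; simp; omega

theorem spec_partitionAt (hv : Models mem n v) {p : ℕ} (hp : p < n) (l : List ℕ)
    (hl : ∀ x ∈ l, x < n) :
    Spec mem (partitionAt p l) fun s c => (s.1 ++ (s.2.1 ++ s.2.2)).Perm l ∧
      (∀ x ∈ s.1, v x < v p) ∧ (∀ x ∈ s.2.1, v x = v p) ∧ (∀ x ∈ s.2.2, v p < v x) ∧
      c ≤ 2 * l.length := by
  induction l with
  | nil => exact Spec.ret (by simp)
  | cons x l ih =>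
    have hx := hl x (by simp)
    refine (ih fun y hy => hl y (by simp [hy])).bind ?_
    rintro ⟨s, e, g⟩ c ⟨hperm, h1, h2, h3, hc⟩
    simp only at hperm h1 h2 h3
    refine (hv.ask hx hp).bind ?_
    rintro b c' ⟨rfl, rfl⟩
    split
    · rename_i h
      have h : v x ≤ v p := by simpa using h
      refine (hv.ask hp hx).bind ?_
      rintro b c' ⟨rfl, rfl⟩
      split
      · rename_i h'
        have h' : v p ≤ v x := by simpa using h'
        refine Spec.ret ⟨?_, h1, ?_, h3, by simp; omega⟩
        · exact List.perm_middle.trans (hperm.cons x)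
        · simp only [List.mem_cons, forall_eq_or_imp]
          exact ⟨le_antisymm h h', h2⟩
      · rename_i h'
        have h' : v x < v p := by simpa using h'
        refine Spec.ret ⟨hperm.cons x, ?_, h2, h3, by simp; omega⟩
        simp only [List.mem_cons, forall_eq_or_imp]
        exact ⟨h', h1⟩
    · rename_i h
      have h : v p < v x := by simpa using h
      refine Spec.ret ⟨?_, h1, h2, ?_, by simp; omega⟩
      · simp only
        rw [← List.append_assoc] at hperm ⊢
        exact List.perm_middle.trans (hperm.cons x)
      · simp only [List.mem_cons, forall_eq_or_imp]
        exact ⟨h, h3⟩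

/-- The pivot is the least element of the upper half of the medians, so both strict sides have about
`7/10` of the elements at most. The constant closes the recursion: `150 / 5` for the medians and
`150 * 7 / 10` for one side leave `15` per element for the linear work and rounding, which suffices
beyond 40 elements. -/
theorem spec_splitSmallest (hv : Models mem n v) (f : ℕ) (l : List ℕ) (k : ℕ)
    (hf : l.length ≤ f) (hl : ∀ x ∈ l, x < n) (hk : k ≤ l.length) :
    Spec mem (splitSmallest f l k) fun r c => (r.1 ++ r.2).Perm l ∧ r.1.length = k ∧
      Below v r.1 r.2 ∧ c ≤ 150 * l.length := by
  induction f generalizing l k with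
  | zero =>
    have : l = [] := by simpa using hf
    subst this
    exact Spec.ret (by simp at hk; simp [Below, hk])
  | succ f ih =>
    unfold splitSmallest
    split
    · rename_i hlen
      refine (spec_sortList hv l hl).bind ?_
      rintro s c ⟨hp, hs, hc⟩
      refine Spec.ret ⟨by simpa using hp, ?_, ?_, by nlinarith⟩
      · simp [hp.length_eq, hk]
      · rw [← List.take_append_drop k s, List.pairwise_append] at hs
        exact hs.2.2
    rename_i hlen
    refine (spec_medians hv l hl).bind ?_
    rintro m c₁ ⟨hm, hml, hc₁, hdown, hup⟩
    refine (ih m (m.length / 2) (by omega) (fun x hx => hl x (hml x hx)) (by omega)).bind ?_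
    rintro ⟨m₁, m₂⟩ c₂ ⟨hp₂, hlen₂, hb₂, hc₂⟩
    simp only at hp₂ hlen₂ hb₂
    have hmm : ∀ x, x ∈ m₁ ∨ x ∈ m₂ → x ∈ m := fun x hx => hp₂.subset (by simpa using hx)
    refine (spec_moveMin hv m₂ fun x hx => hl x (hml x (hmm x (.inr hx)))).bind ?_
    rintro h c₃ ⟨hp₃, hmin, hc₃⟩
    have hlen₃ := hp₂.length_eq
    have hlen₄ := hp₃.length_eq
    rw [List.length_append] at hlen₃
    rcases h with _ | ⟨p, t⟩
    · simp at hlen₄; omega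
    simp only [HeadMin, List.head?_cons, Option.mem_def, Option.some.injEq, forall_eq'] at hmin
    have hpm : p ∈ m₂ := hp₃.subset (by simp)
    have hpl : p ∈ l := hml p (hmm p (.inr hpm))
    refine (spec_partitionAt hv (p := p) (hl p hpl) l hl).bind ?_
    rintro ⟨s, e, g⟩ c₄ ⟨hp₄, hs, he, hg, hc₄⟩
    simp only at hp₄ hs he hg ⊢
    have hlen₅ := hp₄.length_eq
    simp only [List.length_append] at hlen₅
    -- All of `m₂`, at least half of the medians, is at least the pivot, and each median brings
    -- three elements of `e ++ g`. The `12` is the rounding in `l.length / 5`.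
    have hsmall : 10 * s.length ≤ 7 * l.length + 12 := by
      have h1 := hup (fun x => decide (v p ≤ v x)) (by
        intro x y hxy hx
        simp only [decide_eq_true_eq] at hx ⊢
        exact hx.trans hxy)
      rw [← hp₂.countP_eq, ← hp₄.countP_eq, List.countP_append, List.countP_append] at h1
      have h2 : m₂.countP (fun x => decide (v p ≤ v x)) = m₂.length :=
        List.countP_eq_length.2 fun x hx => by simpa using hmin x (hp₃.symm.subset hx)
      have h3 : s.countP (fun x => decide (v p ≤ v x)) = 0 :=
        List.countP_eq_zero.2 fun x hx => by simpa using hs x hx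
      have h4 := List.countP_le_length (p := fun x => decide (v p ≤ v x)) (l := e ++ g)
      rw [List.length_append] at h4
      omega
    -- Here the pivot itself counts in addition to `m₁`, which absorbs the rounding.
    have hlarge : 10 * g.length ≤ 7 * l.length := by
      have h1 := hdown (fun x => decide (v x ≤ v p)) (by
        intro x y hxy hx
        simp only [decide_eq_true_eq] at hx ⊢
        exact hxy.trans hx)
      rw [← hp₂.countP_eq, ← hp₄.countP_eq, ← List.append_assoc, List.countP_append,
        List.countP_append (l₁ := s ++ e)] at h1
      have h2 : m₁.countP (fun x => decide (v x ≤ v p)) = m₁.length :=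
        List.countP_eq_length.2 fun x hx => by simpa using hb₂ x hx p hpm
      have h3 : g.countP (fun x => decide (v x ≤ v p)) = 0 :=
        List.countP_eq_zero.2 fun x hx => by simpa using hg x hx
      have h4 := List.countP_le_length (p := fun x => decide (v x ≤ v p)) (l := s ++ e)
      have h5 : 0 < m₂.countP (fun x => decide (v x ≤ v p)) :=
        List.countP_pos_iff.2 ⟨p, hpm, by simp⟩
      rw [List.length_append] at h4
      omega
    have hsl : ∀ x ∈ s, x < n := fun x hx => hl x (hp₄.subset (by simp [hx]))
    have hgl : ∀ x ∈ g, x < n := fun x hx => hl x (hp₄.subset (by simp [hx]))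
    split
    · rename_i hks
      refine (ih s k (by omega) hsl hks).bind ?_
      rintro ⟨r₁, r₂⟩ c₅ ⟨hp₅, hlen, hb, hc₅⟩
      simp only at hp₅ hlen hb
      refine Spec.ret ⟨?_, hlen, ?_, by omega⟩
      · simp only [← List.append_assoc] at hp₄ hp₅ ⊢
        exact ((hp₅.append_right e).append_right g).trans hp₄
      · intro x hx y hy
        have hxp := hs x (hp₅.subset (by simp [hx]))
        simp only [List.mem_append] at hy
        rcases hy with hy | hy | hy
        · exact hb x hx y hy
        · exact (he y hy).symm ▸ hxp.le
        · exact (hxp.trans (hg y hy)).le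
    split
    · rename_i hks hke
      refine Spec.ret ⟨?_, ?_, ?_, by omega⟩
      · simp only [List.append_assoc]
        rw [← List.append_assoc (e.take _), List.take_append_drop]
        exact hp₄
      · simp; omega
      · have h1 : ∀ x ∈ s ++ e.take (k - s.length), v x ≤ v p := by
          intro x hx
          rcases List.mem_append.1 hx with hx | hx
          · exact (hs x hx).le
          · exact (he x (List.mem_of_mem_take hx)).le
        have h2 : ∀ x ∈ e.drop (k - s.length) ++ g, v p ≤ v x := by
          intro x hx
          rcases List.mem_append.1 hx with hx | hx
          · exact (he x (List.mem_of_mem_drop hx)).ge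
          · exact (hg x hx).le
        exact fun x hx y hy => (h1 x hx).trans (h2 y hy)
    · rename_i hks hke
      refine (ih g (k - s.length - e.length) (by omega) hgl (by omega)).bind ?_
      rintro ⟨r₁, r₂⟩ c₅ ⟨hp₅, hlen, hb, hc₅⟩
      simp only at hp₅ hlen hb
      refine Spec.ret ⟨?_, ?_, ?_, by omega⟩
      · simp only [← List.append_assoc] at hp₄ ⊢
        simp only [List.append_assoc (s ++ e)]
        exact (hp₅.append_left _).trans hp₄
      · simp; omega
      · intro x hx y hy
        have hyp := hg y (hp₅.subset (by simp [hy]))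
        simp only [List.mem_append] at hx
        rcases hx with (hx | hx) | hx
        · exact ((hs x hx).trans hyp).le
        · exact (he x hx).symm ▸ hyp.le
        · exact hb x hx y hy

end

/-! ### Splitting a bucket into many children -/

/-- Add an element to the child that it belongs to, and halve this child if its size exceeds `b`. -/
def insertChild (b f : ℕ) (cs : List (List ℕ)) (x : ℕ) : CompTree (List (List ℕ)) :=
  (bsearch (fun h => ask h x) f (cs.map (·.headD 0))).bind fun k =>
    let c := cs.getD (k - 1) [] ++ [x]
    if c.length ≤ b then .ret (cs.take (k - 1) ++ c :: cs.drop k)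
    else (splitSmallest c.length c (c.length / 2)).bind fun r =>
      (moveMin r.1).bind fun l₁ => (moveMin r.2).bind fun l₂ =>
        .ret (cs.take (k - 1) ++ l₁ :: l₂ :: cs.drop k)

/-- Add elements one by one. -/
def insertChildren (b f : ℕ) : List (List ℕ) → List ℕ → CompTree (List (List ℕ))
  | cs, [] => .ret cs
  | cs, x :: l => (insertChild b f cs x).bind fun cs' => insertChildren b f cs' l

/-- Split a bucket into fewer than `3 * 2 ^ t` children whose sizes are smaller by the factor
`2 ^ t`. -/
def expand (t : ℕ) : List ℕ → CompTree (List (List ℕ))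
  | [] => .ret []
  | x :: l => insertChildren (max 1 ((l.length + 1) / 2 ^ t)) (t + 3) [[x]] l

/-- A list of nonempty buckets in increasing order, each of them starting with its least
element. -/
structure Ordered {β : Type*} [LinearOrder β] (v : ℕ → β) (cs : List (List ℕ)) : Prop where
  below : cs.Pairwise (Below v)
  ne_nil : ∀ c ∈ cs, c ≠ []
  headMin : ∀ c ∈ cs, HeadMin v c

section

variable {α β : Type*} [LinearOrder α] [LinearOrder β] {mem : List α} {n : ℕ} {v : ℕ → β}

theorem countP_splits {ι : Type*} (p : ι → Bool) (l : List ι)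
    (hl : l.Pairwise fun x y => p y = true → p x = true) :
    (∀ y ∈ l.take (l.countP p), p y = true) ∧ ∀ y ∈ l.drop (l.countP p), ¬ p y = true := by
  induction l with
  | nil => simp
  | cons x l ih =>
    rw [List.pairwise_cons] at hl
    by_cases hx : p x = true
    · rw [List.countP_cons_of_pos hx]
      simp only [List.take_succ_cons, List.mem_cons, forall_eq_or_imp, List.drop_succ_cons]
      exact ⟨⟨hx, (ih hl.2).1⟩, (ih hl.2).2⟩
    · have : l.countP p = 0 := List.countP_eq_zero.2 fun y hy hpy => hx (hl.1 y hy hpy)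
      rw [List.countP_cons_of_neg hx, this]
      simp only [List.take_zero, List.not_mem_nil, false_imp_iff, implies_true, List.drop_zero,
        List.mem_cons, forall_eq_or_imp, true_and]
      exact ⟨hx, fun y hy hpy => hx (hl.1 y hy hpy)⟩

theorem HeadMin.headD {c : List ℕ} (h : HeadMin v c) {x : ℕ} (hx : x ∈ c) : v (c.headD 0) ≤ v x := by
  cases c with
  | nil => simp at hx
  | cons y t => exact h y rfl x hx

theorem headD_mem {c : List ℕ} (h : c ≠ []) : c.headD 0 ∈ c := by
  cases c with
  | nil => exact absurd rfl h
  | cons y t => simp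

theorem eq_take_getD_drop {ι : Type*} (l : List ι) (d : ι) {k : ℕ} (hk : 0 < k)
    (hkl : k ≤ l.length) : l = l.take (k - 1) ++ l.getD (k - 1) d :: l.drop k := by
  have h : k - 1 < l.length := by omega
  conv_lhs => rw [← List.take_append_drop (k - 1) l, List.drop_eq_getElem_cons h]
  rw [List.getD_eq_getElem _ _ h, Nat.sub_add_cancel hk]

namespace Ordered

variable {cs ds pre post : List (List ℕ)} {c : List ℕ}

theorem replace (h : Ordered v (pre ++ c :: post)) (hd : Ordered v ds)
    (hs : ∀ d ∈ ds, ∀ x ∈ d, x ∈ c) : Ordered v (pre ++ ds ++ post) := by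
  obtain ⟨h1, h2, h3⟩ := h
  obtain ⟨d1, d2, d3⟩ := hd
  rw [List.pairwise_append, List.pairwise_cons] at h1
  obtain ⟨hpre, ⟨hcp, hpost⟩, hx⟩ := h1
  refine ⟨?_, ?_, ?_⟩
  · rw [List.append_assoc, List.pairwise_append, List.pairwise_append]
    refine ⟨hpre, ⟨d1, hpost, ?_⟩, ?_⟩
    · exact fun a ha b hb x hx y hy => hcp b hb x (hs a ha x hx) y hy
    · intro a ha b hb x hxa y hy
      rcases List.mem_append.1 hb with hb | hb
      · exact hx a ha c (by simp) x hxa y (hs b hb y hy)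
      · exact hx a ha b (by simp [hb]) x hxa y hy
  · intro a ha
    simp only [List.mem_append] at ha
    rcases ha with (ha | ha) | ha
    · exact h2 a (by simp [ha])
    · exact d2 a ha
    · exact h2 a (by simp [ha])
  · intro a ha
    simp only [List.mem_append] at ha
    rcases ha with (ha | ha) | ha
    · exact h3 a (by simp [ha])
    · exact d3 a ha
    · exact h3 a (by simp [ha])

theorem heads_pairwise (h : Ordered v cs) {p : ℕ → Bool}
    (hp : ∀ x y, v x ≤ v y → p y = true → p x = true) :
    (cs.map (·.headD 0)).Pairwise fun x y => p y = true → p x = true := by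
  rw [List.pairwise_map]
  exact h.below.imp_of_mem fun ha hb hab =>
    hp _ _ (hab _ (headD_mem (h.ne_nil _ ha)) _ (headD_mem (h.ne_nil _ hb)))

theorem not_of_countP_heads_eq_zero (h : Ordered v cs) {p : ℕ → Bool}
    (hp : ∀ x y, v x ≤ v y → p y = true → p x = true)
    (hk : (cs.map (·.headD 0)).countP p = 0) : ∀ c ∈ cs, ∀ x ∈ c, ¬ p x = true := by
  intro c hc x hx hpx
  rw [List.countP_eq_zero] at hk
  exact hk _ (List.mem_map_of_mem hc) (hp _ _ ((h.headMin c hc).headD hx) hpx)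

/-- Testing the heads suffices: everything before the last bucket with a passing head is at most
that head, and everything after it is at least a failing head. Only this one bucket can be mixed. -/
theorem split_of_countP_heads (h : Ordered v cs) {p : ℕ → Bool}
    (hp : ∀ x y, v x ≤ v y → p y = true → p x = true) {k : ℕ} (hk : 0 < k)
    (hk' : k = (cs.map (·.headD 0)).countP p) :
    cs = cs.take (k - 1) ++ cs.getD (k - 1) [] :: cs.drop k ∧ k ≤ cs.length ∧
      p ((cs.getD (k - 1) []).headD 0) = true ∧
      (∀ c ∈ cs.take (k - 1), ∀ x ∈ c, p x = true) ∧
      ∀ c ∈ cs.drop k, ∀ x ∈ c, ¬ p x = true := by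
  have hkl : k ≤ cs.length := by
    rw [hk']
    simpa using List.countP_le_length (p := p) (l := cs.map (·.headD 0))
  have hsplit := eq_take_getD_drop cs [] hk hkl
  obtain ⟨h1, h2⟩ := countP_splits p _ (h.heads_pairwise hp)
  rw [← hk'] at h1 h2
  have hc : p ((cs.getD (k - 1) []).headD 0) = true := by
    apply h1
    rw [← List.map_take]
    refine List.mem_map.2 ⟨_, ?_, rfl⟩
    rw [List.getD_eq_getElem _ _ (by omega : k - 1 < cs.length)]
    rw [List.mem_take_iff_getElem]
    exact ⟨k - 1, by omega, rfl⟩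
  refine ⟨hsplit, hkl, hc, ?_, ?_⟩
  · intro c hcm x hx
    refine hp _ _ ?_ hc
    have hb := h.below
    rw [hsplit, List.pairwise_append] at hb
    refine hb.2.2 c hcm _ (by simp) x hx _ (headD_mem (h.ne_nil _ ?_))
    rw [List.getD_eq_getElem _ _ (by omega : k - 1 < cs.length)]
    exact List.getElem_mem _
  · intro c hcm x hx hpx
    have hcm' := List.mem_of_mem_drop hcm
    refine h2 (c.headD 0) ?_ (hp _ _ ((h.headMin c hcm').headD hx) hpx)
    rw [← List.map_drop]
    exact List.mem_map.2 ⟨c, hcm, rfl⟩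

end Ordered

/-- The invariant for the distribution of `l` into children of size at most `b`. -/
structure Children (v : ℕ → β) (b : ℕ) (l : List ℕ) (cs : List (List ℕ)) : Prop where
  perm : cs.flatten.Perm l
  ordered : Ordered v cs
  le : ∀ c ∈ cs, c.length ≤ b
  ge : cs.length = 1 ∨ ∀ c ∈ cs, (b + 1) / 2 ≤ c.length

theorem Children.length_mul_le {b : ℕ} {l : List ℕ} {cs : List (List ℕ)} (h : Children v b l cs) :
    cs.length = 1 ∨ cs.length * ((b + 1) / 2) ≤ l.length := by
  refine h.ge.imp_right fun hge => ?_
  rw [← h.perm.length_eq, List.length_flatten]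
  clear h
  induction cs with
  | nil => simp
  | cons c cs ih =>
    have := ih fun d hd => hge d (by simp [hd])
    have := hge c (by simp)
    simp only [List.length_cons, List.map_cons, List.sum_cons, add_mul]
    omega

/-- Amortization: a child is split only at size `b + 1`, the split and the two searches for minima
cost at most `152 * (b + 1)`, and this is charged to the child that it adds. The hypothesis `hmin`
ensures that the first head is not larger than `x`, so that some child can receive it. -/
theorem spec_insertChild (hv : Models mem n v) {b f : ℕ} (hb : 1 ≤ b) {l : List ℕ}
    {cs : List (List ℕ)} (h : Children v b l cs) (hlen : cs.length < 2 ^ f)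
    (hl : ∀ x ∈ l, x < n) {x : ℕ} (hx : x < n) (hmin : ∃ y ∈ l, v y ≤ v x) :
    Spec mem (insertChild b f cs x) fun cs' c => Children v b (x :: l) cs' ∧
      c + cs.length * (152 * (b + 1)) ≤ f + cs'.length * (152 * (b + 1)) := by
  have hcsl : ∀ c ∈ cs, ∀ y ∈ c, y ∈ l := fun c hc y hy =>
    h.perm.subset (List.mem_flatten.2 ⟨c, hc, hy⟩)
  have hp : ∀ y z, v y ≤ v z → decide (v z ≤ v x) = true → decide (v y ≤ v x) = true := by
    intro y z hyz hz
    simp only [decide_eq_true_eq] at hz ⊢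
    exact hyz.trans hz
  unfold insertChild
  refine (spec_bsearch (p := fun y => decide (v y ≤ v x)) f _ ?_ (h.ordered.heads_pairwise hp)
    (by simpa using hlen)).bind ?_
  · intro y hy
    obtain ⟨c, hc, rfl⟩ := List.mem_map.1 hy
    refine (hv.ask (hl _ (hcsl c hc _ (headD_mem (h.ordered.ne_nil c hc)))) hx).mono ?_
    rintro b c ⟨rfl, rfl⟩
    exact ⟨rfl, le_rfl⟩
  rintro k c₁ ⟨hk, hc₁⟩
  have hk0 : 0 < k := by
    by_contra hk0
    obtain ⟨y, hy, hyx⟩ := hmin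
    obtain ⟨c, hc, hyc⟩ := List.mem_flatten.1 (h.perm.symm.subset hy)
    exact h.ordered.not_of_countP_heads_eq_zero hp (by omega) c hc y hyc (by simpa using hyx)
  obtain ⟨hsplit, hkl, hhead, hpre, hpost⟩ := h.ordered.split_of_countP_heads hp hk0 hk
  generalize cs.take (k - 1) = pre at *
  generalize cs.drop k = post at *
  generalize cs.getD (k - 1) [] = c at *
  subst hsplit
  simp only [decide_eq_true_eq, not_le] at hhead hpre hpost
  have hord := h.ordered
  have hcm : c ∈ pre ++ c :: post := by simp
  have hc0 := hord.ne_nil c hcm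
  have hnew : Ordered v (pre ++ (c ++ [x]) :: post) := by
    obtain ⟨o1, o2, o3⟩ := hord
    rw [List.pairwise_append, List.pairwise_cons] at o1
    refine ⟨?_, ?_, ?_⟩
    · rw [List.pairwise_append, List.pairwise_cons]
      refine ⟨o1.1, ⟨?_, o1.2.1.2⟩, ?_⟩
      · intro d hd y hy z hz
        rcases List.mem_append.1 hy with hy | hy
        · exact o1.2.1.1 d hd y hy z hz
        · rw [List.mem_singleton.1 hy]
          exact (hpost d hd z hz).le
      · intro d hd e he y hy z hz
        rcases List.mem_cons.1 he with rfl | he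
        · rcases List.mem_append.1 hz with hz | hz
          · exact o1.2.2 d hd c (by simp) y hy z hz
          · rw [List.mem_singleton.1 hz]
            exact hpre d hd y hy
        · exact o1.2.2 d hd e (by simp [he]) y hy z hz
    · intro d hd
      rcases List.mem_append.1 hd with hd | hd
      · exact o2 d (by simp [hd])
      rcases List.mem_cons.1 hd with rfl | hd
      · simp
      · exact o2 d (by simp [hd])
    · intro d hd
      rcases List.mem_append.1 hd with hd | hd
      · exact o3 d (by simp [hd])
      rcases List.mem_cons.1 hd with rfl | hd
      · have := o3 c (by simp)
        rcases c with _ | ⟨y, t⟩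
        · exact absurd rfl hc0
        intro z hz w hw
        obtain rfl : y = z := by simpa using hz
        rcases List.mem_append.1 hw with hw | hw
        · exact this y rfl w hw
        · rw [List.mem_singleton.1 hw]
          exact hhead
      · exact o3 d (by simp [hd])
  have hperm : (pre ++ (c ++ [x]) :: post).flatten.Perm (x :: l) := by
    refine List.Perm.trans ?_ (h.perm.cons x)
    simp only [List.flatten_append, List.flatten_cons, List.append_assoc, List.singleton_append]
    rw [← List.append_assoc, ← List.append_assoc]
    exact List.perm_middle
  simp only
  split
  · rename_i hlb
    refine Spec.ret ⟨⟨hperm, hnew, ?_, ?_⟩, ?_⟩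
    · intro d hd
      rcases List.mem_append.1 hd with hd | hd
      · exact h.le d (by simp [hd])
      rcases List.mem_cons.1 hd with rfl | hd
      · exact hlb
      · exact h.le d (by simp [hd])
    · refine h.ge.imp (by simp) fun hge d hd => ?_
      rcases List.mem_append.1 hd with hd | hd
      · exact hge d (by simp [hd])
      rcases List.mem_cons.1 hd with rfl | hd
      · have := hge c (by simp)
        simp; omega
      · exact hge d (by simp [hd])
    · simp; omega
  · rename_i hlb
    have hcb := h.le c hcm
    have hclen : (c ++ [x]).length = b + 1 := by
      simp only [List.length_append, List.length_singleton] at hlb ⊢; omega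
    have hcn : ∀ y ∈ c ++ [x], y < n := by
      intro y hy
      rcases List.mem_append.1 hy with hy | hy
      · exact hl y (hcsl c hcm y hy)
      · rw [List.mem_singleton.1 hy]; exact hx
    refine (spec_splitSmallest hv _ (c ++ [x]) ((c ++ [x]).length / 2) le_rfl hcn (by omega)).bind ?_
    rintro ⟨r₁, r₂⟩ c₂ ⟨hp₂, hlen₂, hb₂, hc₂⟩
    simp only at hp₂ hlen₂ hb₂
    have hrn : ∀ y, y ∈ r₁ ∨ y ∈ r₂ → y ∈ c ++ [x] := fun y hy => hp₂.subset (by simpa using hy)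
    refine (spec_moveMin hv r₁ fun y hy => hcn y (hrn y (.inl hy))).bind ?_
    rintro l₁ c₃ ⟨hp₃, hm₃, hc₃⟩
    refine (spec_moveMin hv r₂ fun y hy => hcn y (hrn y (.inr hy))).bind ?_
    rintro l₂ c₄ ⟨hp₄, hm₄, hc₄⟩
    have hlen₅ := hp₂.length_eq
    rw [List.length_append] at hlen₅
    have e₁ := hp₃.length_eq
    have e₂ := hp₄.length_eq
    have hds : Ordered v [l₁, l₂] := by
      refine ⟨?_, ?_, ?_⟩
      · simp only [List.pairwise_cons, List.mem_singleton, forall_eq, List.not_mem_nil,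
          false_imp_iff, implies_true, List.Pairwise.nil, and_self, and_true]
        exact fun y hy z hz => hb₂ y (hp₃.subset hy) z (hp₄.subset hz)
      · intro d hd hd0
        simp only [List.mem_cons, List.not_mem_nil, or_false] at hd
        rcases hd with rfl | rfl <;> subst hd0 <;> simp at e₁ e₂ <;> omega
      · simp [hm₃, hm₄]
    refine Spec.ret ⟨⟨?_, ?_, ?_, ?_⟩, ?_⟩
    · refine List.Perm.trans ?_ hperm
      simp only [List.flatten_append, List.flatten_cons]
      refine List.Perm.append_left _ ?_
      rw [← List.append_assoc]
      exact ((hp₃.append hp₄).trans hp₂).append_right _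
    · have := hnew.replace hds (by
        intro d hd y hy
        simp only [List.mem_cons, List.not_mem_nil, or_false] at hd
        rcases hd with rfl | rfl
        · exact hrn y (.inl (hp₃.subset hy))
        · exact hrn y (.inr (hp₄.subset hy)))
      simpa using this
    · intro d hd
      simp only [List.mem_append, List.mem_cons] at hd
      rcases hd with hd | rfl | rfl | hd
      · exact h.le d (by simp [hd])
      · omega
      · omega
      · exact h.le d (by simp [hd])
    -- After a split no exception for a single child is needed: if there was only one, `pre` and
    -- `post` are empty, and both halves of `b + 1` elements are large enough.
    · right
      have hge : ∀ d, d ∈ pre ∨ d ∈ post → (b + 1) / 2 ≤ d.length := by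
        intro d hd
        rcases h.ge with h1 | h1
        · simp only [List.length_append, List.length_cons] at h1
          rcases hd with hd | hd <;> have := List.length_pos_of_mem hd <;> omega
        · exact h1 d (by simp only [List.mem_append, List.mem_cons]; tauto)
      intro d hd
      simp only [List.mem_append, List.mem_cons] at hd
      rcases hd with hd | rfl | rfl | hd
      · exact hge d (.inl hd)
      · omega
      · omega
      · exact hge d (.inr hd)
    · have : (pre ++ l₁ :: l₂ :: post).length = (pre ++ c :: post).length + 1 := by
        simp; omega
      rw [this, add_mul]
      omega

theorem spec_insertChildren (hv : Models mem n v) {b t N : ℕ} (hb : 1 ≤ b)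
    (hN : N < 2 ^ t * (b + 1)) (m : List ℕ) {l : List ℕ} {cs : List (List ℕ)}
    (h : Children v b l cs) (hlN : l.length + m.length ≤ N)
    (hl : ∀ x ∈ l, x < n) (hm : ∀ x ∈ m, x < n) (hmin : ∃ y ∈ l, ∀ x ∈ m, v y ≤ v x) :
    Spec mem (insertChildren b (t + 3) cs m) fun cs' c => Children v b (m ++ l) cs' ∧
      c + cs.length * (152 * (b + 1)) ≤ m.length * (t + 3) + cs'.length * (152 * (b + 1)) := by
  induction m generalizing l cs with
  | nil => exact Spec.ret ⟨by simpa using h, by simp⟩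
  | cons x m ih =>
    -- Children have at least `(b + 1) / 2 ≥ (b + 1) / 3` elements (rounded down on the left), and
    -- there are fewer than `2 ^ t * (b + 1)` elements, so `t + 3` probes always suffice.
    have hlen : cs.length < 2 ^ (t + 3) := by
      have : 0 < 2 ^ t := by positivity
      rw [pow_add]
      rcases h.length_mul_le with h1 | h1
      · omega
      · have h2 : b + 1 ≤ 3 * ((b + 1) / 2) := by omega
        simp only [List.length_cons] at hlN
        by_contra h3
        have h4 : 8 * 2 ^ t ≤ cs.length := by omega
        have h5 := Nat.mul_le_mul_right ((b + 1) / 2) h4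
        have h6 := Nat.mul_le_mul_left (2 ^ t) h2
        nlinarith
    simp only [List.mem_cons, forall_eq_or_imp] at hm hmin
    obtain ⟨y, hy, hyx, hym⟩ := hmin
    refine (spec_insertChild hv hb h hlen hl hm.1 ⟨y, hy, hyx⟩).bind ?_
    rintro cs' c₁ ⟨h', hc₁⟩
    refine (ih h' (by simp at hlN ⊢; omega) (by simpa using ⟨hm.1, hl⟩) hm.2
      ⟨y, by simp [hy], hym⟩).mono ?_
    rintro cs'' c₂ ⟨h'', hc₂⟩
    refine ⟨⟨h''.perm.trans ?_, h''.ordered, h''.le, h''.ge⟩, ?_⟩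
    · exact List.perm_middle
    · simp only [List.length_cons, add_mul]
      omega

/-- The `459` is `3 + 3 * 152`: each insertion takes `t + 3` probes, and all splits together cost at
most `152 * (b + 1)` per child, where the number of children times `b + 1` is at most three times
the number of elements. -/
theorem spec_expand (hv : Models mem n v) (t : ℕ) (l : List ℕ) (hl : ∀ x ∈ l, x < n) (h0 : l ≠ [])
    (hmin : HeadMin v l) :
    Spec mem (expand t l) fun cs c => cs.flatten.Perm l ∧ Ordered v cs ∧
      (∀ d ∈ cs, d.length ≤ max 1 (l.length / 2 ^ t)) ∧ cs.length < 2 ^ (t + 2) ∧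
      c ≤ l.length * (t + 459) := by
  rcases l with _ | ⟨x, l⟩
  · exact absurd rfl h0
  unfold expand
  have hpow : 0 < 2 ^ t := by positivity
  set b := max 1 ((l.length + 1) / 2 ^ t) with hb
  have hb1 : 1 ≤ b := le_max_left _ _
  have hN : l.length + 1 < 2 ^ t * (b + 1) := by
    have h1 : (l.length + 1) / 2 ^ t ≤ b := le_max_right _ _
    have h2 := Nat.lt_mul_div_succ (l.length + 1) hpow
    exact h2.trans_le (Nat.mul_le_mul_left _ (by omega))
  have hinit : Children v b [x] [[x]] := by
    exact ⟨by simp, ⟨by simp, by simp, by simp [HeadMin]⟩, by simpa using hb1, by simp⟩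
  refine (spec_insertChildren hv hb1 hN l hinit (by simp; omega) (by simpa using hl x (by simp))
    (fun y hy => hl y (by simp [hy])) ⟨x, by simp, fun y hy => hmin x rfl y (by simp [hy])⟩).mono ?_
  rintro cs c ⟨h, hc⟩
  have hlen := h.length_mul_le
  have h2 : b + 1 ≤ 3 * ((b + 1) / 2) := by omega
  simp only [List.length_append, List.length_cons, List.length_nil] at hlen hc ⊢
  refine ⟨h.perm.trans (by simp), h.ordered,
    h.le, ?_, ?_⟩
  · rw [pow_add]
    rcases hlen with h1 | h1
    · omega
    · by_contra h3
      have h4 : 4 * 2 ^ t ≤ cs.length := by omega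
      have h5 := Nat.mul_le_mul_right ((b + 1) / 2) h4
      have h6 := Nat.mul_le_mul_left (2 ^ t) h2
      nlinarith
  · rcases hlen with h1 | h1
    · rw [h1] at hc
      nlinarith
    · have h6 := Nat.mul_le_mul_left cs.length h2
      nlinarith

end

/-! ### The lazily refined partition -/

/-- A bucket consists of its level and the addresses that it contains. -/
abbrev Bucket := ℕ × List ℕ

/-- The number of addresses in a list of buckets. -/
def total (bs : List Bucket) : ℕ := (bs.map fun b => b.2.length).sum

/-- The levels of the buckets, repeated according to their sizes. -/
def levels (bs : List Bucket) : List ℕ := bs.flatMap fun b => List.replicate b.2.length b.1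

/-- The binary logarithm of the factor by which a bucket of level `j` is smaller than the array. -/
def depth : ℕ → ℕ
  | 0 => 0
  | j + 1 => depth j + (j + 1)

/-- The number of comparisons per element spent on the creation of a bucket of level `j`. -/
def weight : ℕ → ℕ
  | 0 => 0
  | j + 1 => weight j + (j + 1 + 459)

/-- The number of comparisons for a search that passes through the levels up to `j`. -/
def pathWeight : ℕ → ℕ
  | 0 => 0
  | j + 1 => pathWeight j + (j + 3)

/-- The number of comparisons spent on the creation of all buckets. -/
def potential (bs : List Bucket) : ℕ := ((levels bs).map weight).sum

@[simp] theorem total_nil : total [] = 0 := rfl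

@[simp] theorem total_cons (b : Bucket) (bs : List Bucket) :
    total (b :: bs) = b.2.length + total bs := by simp [total]

@[simp] theorem total_append (bs bs' : List Bucket) :
    total (bs ++ bs') = total bs + total bs' := by simp [total]

theorem levels_cons (b : Bucket) (bs : List Bucket) :
    levels (b :: bs) = List.replicate b.2.length b.1 ++ levels bs := by simp [levels]

theorem levels_append (bs bs' : List Bucket) :
    levels (bs ++ bs') = levels bs ++ levels bs' := by simp [levels]

theorem length_levels (bs : List Bucket) : (levels bs).length = total bs := by
  simp [levels, total, List.length_flatMap]

theorem total_eq_length_flatten (bs : List Bucket) :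
    total bs = (bs.map (·.2)).flatten.length := by
  simp [total, List.length_flatten, List.map_map, Function.comp_def]

theorem levels_children (j : ℕ) (cs : List (List ℕ)) :
    levels (cs.map fun c => (j, c)) = List.replicate cs.flatten.length j := by
  induction cs with
  | nil => rfl
  | cons c cs ih =>
    rw [List.map_cons, levels_cons, ih]
    simp

theorem map_snd_children (j : ℕ) (cs : List (List ℕ)) :
    (cs.map fun c => ((j, c) : Bucket)).map (·.2) = cs := by
  simp [List.map_map, Function.comp_def]

/-- Both sides are quadratic in `j`. As `2 ^ depth j ≤ n` along every path, this makes the probes of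
one search `O(log n)`. -/
theorem pathWeight_succ_le (j : ℕ) : pathWeight (j + 1) ≤ 4 * depth j + 3 := by
  induction j with
  | zero => simp [pathWeight, depth]
  | succ j ih =>
    rw [pathWeight, depth]
    omega

/-- Refine the bucket in focus until it is a singleton; `pick` chooses the new focus among the
children.  The first argument bounds the depth of the recursion. -/
def descend (pick : List Bucket → List Bucket → CompTree ℕ) :
    ℕ → List Bucket → Bucket → List Bucket → CompTree (List Bucket × Bucket × List Bucket)
  | 0, pre, b, post => .ret (pre, b, post)
  | f + 1, pre, b, post =>
    if b.2.length ≤ 1 then .ret (pre, b, post)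
    else (expand (b.1 + 1) b.2).bind fun cs =>
      let bs := cs.map fun c => (b.1 + 1, c)
      (pick pre bs).bind fun k =>
        descend pick f (pre ++ bs.take k) (bs.getD k (0, [])) (bs.drop (k + 1) ++ post)

/-- Refine the partition at the place determined by `pick`. -/
def locate (pick : List Bucket → List Bucket → CompTree ℕ) (bs : List Bucket) :
    CompTree (List Bucket × Bucket × List Bucket) :=
  (pick [] bs).bind fun k =>
    descend pick (total bs) (bs.take k) (bs.getD k (0, [])) (bs.drop (k + 1))

/-- The index of the bucket that contains the `r`-th smallest element. -/
def bucketIndex : ℕ → List Bucket → ℕ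
  | _, [] => 0
  | r, b :: bs => if r ≤ b.2.length then 0 else bucketIndex (r - b.2.length) bs + 1

/-- Choose the bucket that contains the `r`-th smallest element. -/
def pickRank (r : ℕ) (pre bs : List Bucket) : CompTree ℕ :=
  .ret (bucketIndex (r - total pre) bs)

/-- Choose the last bucket whose least element passes the test. -/
def pickTest (test : ℕ → CompTree Bool) (_ bs : List Bucket) : CompTree ℕ :=
  (bsearch test bs.length.size ((bs.map (·.2)).map (·.headD 0))).bind fun k => .ret (k - 1)

/-- The number of addresses that pass a test, together with the refined partition. -/
def rankOf (test : ℕ → CompTree Bool) : List Bucket → CompTree (ℕ × List Bucket)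
  | [] => .ret (0, [])
  | b :: bs => (test (b.2.headD 0)).bind fun t =>
      if t then (locate (pickTest test) (b :: bs)).bind fun s =>
        .ret (total s.1 + 1, s.1 ++ s.2.1 :: s.2.2)
      else .ret (0, b :: bs)

/-- The invariant of the partition of the addresses below `n` according to their values `v`, where
every refinement is due to a position in `T`. -/
structure Partition {β : Type*} [LinearOrder β] (v : ℕ → β) (n : ℕ) (T : Set ℕ)
    (bs : List Bucket) : Prop where
  perm : (bs.map (·.2)).flatten.Perm (List.range n)
  ordered : Ordered v (bs.map (·.2))
  small : ∀ b ∈ bs, 2 ≤ b.2.length → b.2.length * 2 ^ depth b.1 ≤ n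
  charged : ∀ k j, (levels bs)[k]? = some (j + 1) →
    ∃ s ∈ T, max 1 (Nat.dist (k + 1) s) * 2 ^ depth j ≤ n

/-! ### Maintenance of the partition and the cost of locating a rank -/

section

variable {α β : Type*} [LinearOrder α] [LinearOrder β] {mem : List α} {n : ℕ} {v : ℕ → β}
  {T : Set ℕ}

namespace Partition

variable {bs pre post : List Bucket} {b : Bucket}

theorem total_eq (h : Partition v n T bs) : total bs = n := by
  rw [total_eq_length_flatten, h.perm.length_eq, List.length_range]

theorem ne_nil (h : Partition v n T bs) {b : Bucket} (hb : b ∈ bs) : b.2 ≠ [] :=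
  h.ordered.ne_nil _ (List.mem_map_of_mem hb)

theorem lt_of_mem (h : Partition v n T bs) {b : Bucket} (hb : b ∈ bs) {x : ℕ} (hx : x ∈ b.2) :
    x < n :=
  List.mem_range.1 (h.perm.subset (List.mem_flatten.2 ⟨b.2, List.mem_map_of_mem hb, hx⟩))

theorem length_le (h : Partition v n T bs) : bs.length ≤ n := by
  rw [← h.total_eq]
  have : ∀ b ∈ bs, 1 ≤ b.2.length := fun b hb => List.length_pos_of_ne_nil (h.ne_nil hb)
  clear h
  induction bs with
  | nil => simp
  | cons b bs ih =>
    have h1 := ih fun c hc => this c (by simp [hc])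
    have h2 := this b (by simp)
    simp only [List.length_cons, total_cons]
    omega

/-- The refined bucket occupies consecutive ranks, one of them `r`, so each of its ranks is within
`b.2.length` of `s`; the size bound of level `b.1` then gives the charge for the new level `b.1 +
1`. The slack `Nat.dist r s ≤ 1` is free because two ranks in the bucket differ by at most its size
minus one. The potential grows by exactly the bound of `spec_expand`. -/
theorem expand (h : Partition v n T (pre ++ b :: post)) (hb : 2 ≤ b.2.length) {r s : ℕ}
    (hr : total pre < r) (hr' : r ≤ total pre + b.2.length) (hs : s ∈ T) (hrs : Nat.dist r s ≤ 1)
    {cs : List (List ℕ)} (hp : cs.flatten.Perm b.2) (ho : Ordered v cs)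
    (hlen : ∀ d ∈ cs, d.length ≤ max 1 (b.2.length / 2 ^ (b.1 + 1))) :
    Partition v n T (pre ++ cs.map (fun c => (b.1 + 1, c)) ++ post) ∧
      potential (pre ++ cs.map (fun c => (b.1 + 1, c)) ++ post) =
        potential (pre ++ b :: post) + b.2.length * (b.1 + 1 + 459) := by
  have hsmall := h.small b (by simp) hb
  refine ⟨⟨?_, ?_, ?_, ?_⟩, ?_⟩
  · refine List.Perm.trans ?_ h.perm
    simp only [List.map_append, map_snd_children, List.flatten_append, List.map_cons,
      List.flatten_cons, List.append_assoc]
    exact (hp.append_right _).append_left _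
  · simp only [List.map_append, map_snd_children]
    refine Ordered.replace (c := b.2) (by simpa using h.ordered) ho fun d hd x hx => ?_
    exact hp.subset (List.mem_flatten.2 ⟨d, hd, hx⟩)
  · intro d hd hd2
    simp only [List.mem_append, List.mem_map] at hd
    rcases hd with (hd | ⟨c, hc, rfl⟩) | hd
    · exact h.small d (by simp [hd]) hd2
    · have h1 := hlen c hc
      have h2 : c.length ≤ b.2.length / 2 ^ (b.1 + 1) := by
        simp only at hd2
        omega
      simp only [depth, pow_add 2 (depth b.1)]
      rw [mul_comm (2 ^ depth b.1), ← mul_assoc]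
      exact (Nat.mul_le_mul_right _ ((Nat.mul_le_mul_right _ h2).trans
        (Nat.div_mul_le_self _ _))).trans hsmall
    · exact h.small d (by simp [hd]) hd2
  · intro k j hk
    have hold := h.charged k j
    simp only [levels_append, levels_cons, levels_children, hp.length_eq, List.append_assoc] at hk hold
    rcases lt_or_ge k (total pre) with h1 | h1
    · rw [List.getElem?_append_left (by rwa [length_levels])] at hk hold
      exact hold hk
    rw [List.getElem?_append_right (by rwa [length_levels]), length_levels] at hk hold
    rcases lt_or_ge (k - total pre) b.2.length with h2 | h2
    · rw [List.getElem?_append_left (by simpa using h2), List.getElem?_replicate, if_pos h2] at hk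
      obtain rfl : b.1 = j := by simpa using hk
      refine ⟨s, hs, (Nat.mul_le_mul_right _ ?_).trans hsmall⟩
      unfold Nat.dist at *
      omega
    · rw [List.getElem?_append_right (by simpa using h2), List.length_replicate] at hk hold
      exact hold hk
  · simp only [potential, levels_append, levels_cons, levels_children, hp.length_eq,
      List.map_append, List.sum_append, List.map_replicate, List.sum_replicate, weight,
      smul_eq_mul]
    ring

end Partition

/-- `pick` chooses the bucket that contains the `r`-th smallest element, with `κ` times the
comparisons of a binary search. -/
def Guides (mem : List α) (v : ℕ → β) (n : ℕ) (T : Set ℕ)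
    (pick : List Bucket → List Bucket → CompTree ℕ) (r κ : ℕ) : Prop :=
  ∀ pre bs post, Partition v n T (pre ++ bs ++ post) → total pre < r →
    r ≤ total pre + total bs → Spec mem (pick pre bs) fun k c => k < bs.length ∧
      total (pre ++ bs.take k) < r ∧ r ≤ total (pre ++ bs.take (k + 1)) ∧ c ≤ κ * bs.length.size

theorem split_at_index {ι : Type*} (l : List ι) (d : ι) {k : ℕ} (hk : k < l.length) :
    l = l.take k ++ l.getD k d :: l.drop (k + 1) := by
  simpa using eq_take_getD_drop l d (k := k + 1) (by omega) hk

theorem take_succ_getD {ι : Type*} (l : List ι) (d : ι) {k : ℕ} (hk : k < l.length) :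
    l.take (k + 1) = l.take k ++ [l.getD k d] := by
  rw [List.take_succ_eq_append_getElem hk, List.getD_eq_getElem _ _ hk]

/-- Refinements are paid by the growth of the potential, choices of children by the growth of
`pathWeight`, since fewer than `2 ^ (b.1 + 3)` children need at most `b.1 + 3` probes. The size of
the focus is enough fuel because children of a bucket with two or more elements are strictly
smaller. -/
theorem spec_descend (hv : Models mem n v) {pick : List Bucket → List Bucket → CompTree ℕ}
    {r κ s : ℕ} (hg : Guides mem v n T pick r κ) (hs : s ∈ T) (hrs : Nat.dist r s ≤ 1) (f : ℕ)
    (pre : List Bucket) (b : Bucket) (post : List Bucket)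
    (h : Partition v n T (pre ++ b :: post)) (hf : b.2.length ≤ f) (hr : total pre < r)
    (hr' : r ≤ total pre + b.2.length) :
    Spec mem (descend pick f pre b post) fun o c =>
      Partition v n T (o.1 ++ o.2.1 :: o.2.2) ∧ o.2.1.2.length = 1 ∧ total o.1 + 1 = r ∧
        c + potential (pre ++ b :: post) + κ * pathWeight b.1 ≤
          potential (o.1 ++ o.2.1 :: o.2.2) + κ * pathWeight o.2.1.1 := by
  induction f generalizing pre b post with
  | zero =>
    have := List.length_pos_of_ne_nil (h.ne_nil (b := b) (by simp))
    omega
  | succ f ih =>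
    have hpos := List.length_pos_of_ne_nil (h.ne_nil (b := b) (by simp))
    unfold descend
    split
    · exact Spec.ret ⟨h, by simp only; omega, by simp only; omega, by simp⟩
    rename_i hb
    refine (spec_expand hv (b.1 + 1) b.2 (fun x hx => h.lt_of_mem (by simp) hx)
      (h.ne_nil (by simp)) (h.ordered.headMin _ (by simp))).bind ?_
    rintro cs c₁ ⟨hp, ho, hlen, hcount, hc₁⟩
    obtain ⟨hP, hpot⟩ := h.expand (by omega) hr hr' hs hrs hp ho hlen
    simp only
    have hlen' : ∀ d ∈ cs.map (fun c => ((b.1 + 1, c) : Bucket)), d.2.length ≤ f := by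
      intro d hd
      obtain ⟨c, hc, rfl⟩ := List.mem_map.1 hd
      have h1 := hlen c hc
      have h2 : b.2.length / 2 ^ (b.1 + 1) ≤ b.2.length / 2 :=
        Nat.div_le_div_left (by rw [pow_succ]; have := Nat.one_le_two_pow (n := b.1); omega)
          (by norm_num)
      simp only
      omega
    have hlev : ∀ d ∈ cs.map (fun c => ((b.1 + 1, c) : Bucket)), d.1 = b.1 + 1 := by
      intro d hd
      obtain ⟨c, hc, rfl⟩ := List.mem_map.1 hd
      rfl
    have hbs : (cs.map (fun c => ((b.1 + 1, c) : Bucket))).length = cs.length := by simp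
    have htot : total (cs.map (fun c => ((b.1 + 1, c) : Bucket))) = b.2.length := by
      rw [total_eq_length_flatten, map_snd_children, hp.length_eq]
    generalize cs.map (fun c => ((b.1 + 1, c) : Bucket)) = bs at *
    refine (hg pre bs post hP hr (by omega)).bind ?_
    rintro k c₂ ⟨hk, hk1, hk2, hc₂⟩
    have hsplit := split_at_index bs (0, []) hk
    have hmem : bs.getD k (0, []) ∈ bs := by
      rw [List.getD_eq_getElem _ _ hk]; exact List.getElem_mem _
    rw [take_succ_getD bs (0, []) hk, ← List.append_assoc, total_append (pre ++ _), total_cons,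
      total_nil] at hk2
    have hlist : pre ++ bs ++ post =
        pre ++ bs.take k ++ bs.getD k (0, []) :: (bs.drop (k + 1) ++ post) := by
      conv_lhs => rw [hsplit]
      simp
    rw [hlist] at hP hpot
    refine (ih _ _ _ hP (hlen' _ hmem) hk1 (by omega)).mono ?_
    rintro o c₃ ⟨g1, g2, g3, g4⟩
    refine ⟨g1, g2, g3, ?_⟩
    rw [hpot, hlev _ hmem, pathWeight, mul_add κ] at g4
    have hsize : bs.length.size ≤ b.1 + 3 := Nat.size_le.2 (by rw [hbs]; exact hcount)
    have := Nat.mul_le_mul_left κ hsize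
    omega

theorem spec_locate (hv : Models mem n v) {pick : List Bucket → List Bucket → CompTree ℕ}
    {r κ s : ℕ} (hg : Guides mem v n T pick r κ) (hs : s ∈ T) (hrs : Nat.dist r s ≤ 1)
    {bs : List Bucket} (h : Partition v n T bs) (hr : 0 < r) (hr' : r ≤ n) :
    Spec mem (locate pick bs) fun o c =>
      Partition v n T (o.1 ++ o.2.1 :: o.2.2) ∧ o.2.1.2.length = 1 ∧ total o.1 + 1 = r ∧
        c + potential bs ≤ potential (o.1 ++ o.2.1 :: o.2.2) + κ * (5 * n.size + 3) := by
  unfold locate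
  refine (hg [] bs [] (by simpa using h) (by simpa using hr) (by simpa [h.total_eq])).bind ?_
  rintro k c₁ ⟨hk, hk1, hk2, hc₁⟩
  rw [List.nil_append] at hk1 hk2
  have hsplit := split_at_index bs (0, []) hk
  have hmem : bs.getD k (0, []) ∈ bs := by
    rw [List.getD_eq_getElem _ _ hk]; exact List.getElem_mem _
  rw [take_succ_getD bs (0, []) hk, total_append, total_cons, total_nil] at hk2
  have hle : (bs.getD k (0, [])).2.length ≤ total bs := by
    conv_rhs => rw [hsplit]
    rw [total_append, total_cons]; omega
  refine (spec_descend hv hg hs hrs (total bs) _ _ _ (hsplit ▸ h) hle hk1 (by omega)).mono ?_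
  rintro ⟨pre, b, post⟩ c₂ ⟨g1, g2, g3, g4⟩
  refine ⟨g1, g2, g3, ?_⟩
  rw [← hsplit] at g4
  simp only at g1 g2 g3 g4 ⊢
  -- The final focus has level `j + 1` only if its parent was charged, and the factor `max 1 _` in
  -- the charge gives `2 ^ depth j ≤ n`.
  have hpath : pathWeight b.1 ≤ 4 * n.size + 3 := by
    rcases hj : b.1 with _ | j
    · simp [pathWeight]
    · obtain ⟨t, -, ht⟩ := g1.charged (total pre) j (by
        rw [levels_append, levels_cons, List.getElem?_append_right (by rw [length_levels]),
          length_levels, g2, hj]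
        simp)
      have h1 : 2 ^ depth j ≤ n := le_trans (Nat.le_mul_of_pos_left _ (by omega)) ht
      have h2 := Nat.lt_size.2 h1
      have h3 := pathWeight_succ_le j
      omega
  have hsize : bs.length.size ≤ n.size := Nat.size_le_size h.length_le
  have h1 := Nat.mul_le_mul_left κ hsize
  have h2 := Nat.mul_le_mul_left κ hpath
  have h3 : κ * (5 * n.size + 3) = κ * n.size + κ * (4 * n.size + 3) := by ring
  omega

theorem bucketIndex_spec (r : ℕ) (bs : List Bucket) (hr : 0 < r) (hr' : r ≤ total bs) :
    bucketIndex r bs < bs.length ∧ total (bs.take (bucketIndex r bs)) < r ∧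
      r ≤ total (bs.take (bucketIndex r bs + 1)) := by
  induction bs generalizing r with
  | nil => simp at hr'; omega
  | cons b bs ih =>
    unfold bucketIndex
    split
    · simpa using ⟨hr, by assumption⟩
    · rename_i h
      rw [total_cons] at hr'
      obtain ⟨h1, h2, h3⟩ := ih (r - b.2.length) (by omega) (by omega)
      simp only [List.length_cons, List.take_succ_cons, total_cons] at h3 ⊢
      omega

/-- Bucket sizes are known, so `κ = 0`: a selection costs nothing beyond refinement. -/
theorem guides_pickRank (r : ℕ) : Guides mem v n T (pickRank r) r 0 := by
  intro pre bs post _ hr hr'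
  obtain ⟨h1, h2, h3⟩ := bucketIndex_spec (r - total pre) bs (by omega) (by omega)
  refine Spec.ret ⟨h1, ?_, ?_, by simp⟩ <;> rw [total_append] <;> omega

theorem countP_le_total {p : ℕ → Bool} {bs : List Bucket} :
    (bs.map (·.2)).flatten.countP p ≤ total bs := by
  rw [total_eq_length_flatten]
  exact List.countP_le_length

/-- The passing elements are the smallest ones, and `r` is their number, so the `r`-th smallest is
the last that passes and lies in the last bucket whose head passes. -/
theorem guides_pickTest {test : ℕ → CompTree Bool} {p : ℕ → Bool}
    (ht : ∀ x < n, Spec mem (test x) fun b c => b = p x ∧ c ≤ 1)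
    (hp : ∀ x y, v x ≤ v y → p y = true → p x = true) :
    Guides mem v n T (pickTest test) ((List.range n).countP p) 1 := by
  intro pre bs post h hr hr'
  have hcount : (List.range n).countP p = (pre.map (·.2)).flatten.countP p +
      ((bs.map (·.2)).flatten.countP p + (post.map (·.2)).flatten.countP p) := by
    rw [← h.perm.countP_eq]
    simp [List.countP_append]
  have hord := h.ordered
  rw [List.map_append, List.map_append] at hord
  obtain ⟨o1, o2, o3⟩ := hord
  rw [List.append_assoc, List.pairwise_append, List.pairwise_append] at o1
  have hbs : Ordered v (bs.map (·.2)) :=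
    ⟨o1.2.1.1, fun c hc => o2 c (by simp only [List.mem_append]; tauto),
      fun c hc => o3 c (by simp only [List.mem_append]; tauto)⟩
  have hpost : Ordered v (post.map (·.2)) :=
    ⟨o1.2.1.2.1, fun c hc => o2 c (by simp only [List.mem_append]; tauto),
      fun c hc => o3 c (by simp only [List.mem_append]; tauto)⟩
  unfold pickTest
  refine (spec_bsearch (p := p) bs.length.size _ ?_ (hbs.heads_pairwise hp)
    (by simpa using Nat.lt_size_self bs.length)).bind ?_
  · intro x hx
    rw [List.map_map] at hx
    obtain ⟨b, hb, rfl⟩ := List.mem_map.1 hx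
    have hb' : b ∈ pre ++ bs ++ post := by simp [hb]
    exact ht _ (h.lt_of_mem hb' (headD_mem (h.ne_nil hb')))
  rintro k c ⟨hk, hc⟩
  have hk0 : 0 < k := by
    by_contra hk0
    have h1 := hbs.not_of_countP_heads_eq_zero hp (by omega)
    have h2 : (bs.map (·.2)).flatten.countP p = 0 := by
      refine List.countP_eq_zero.2 fun x hx => ?_
      obtain ⟨c, hc, hx⟩ := List.mem_flatten.1 hx
      exact h1 c hc x hx
    have h3 : (post.map (·.2)).flatten.countP p = 0 := by
      refine List.countP_eq_zero.2 fun x hx hpx => ?_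
      obtain ⟨d, hd, hx⟩ := List.mem_flatten.1 hx
      rcases bs with _ | ⟨b, bs⟩
      · simp at hr'; omega
      have hb := headD_mem (hbs.ne_nil b.2 (by simp))
      exact h1 b.2 (by simp) _ hb (hp _ _ (o1.2.1.2.2 b.2 (by simp) d hd _ hb x hx) hpx)
    have h4 := countP_le_total (p := p) (bs := pre)
    omega
  obtain ⟨hsplit, hkl, hhead, hbefore, hafter⟩ := hbs.split_of_countP_heads hp hk0 hk
  rw [List.length_map] at hkl
  have hk1 : k - 1 < bs.length := by omega
  have hget : (bs.map (·.2)).getD (k - 1) [] = (bs.getD (k - 1) (0, [])).2 := by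
    rw [List.getD_eq_getElem _ _ (by simpa using hk1), List.getD_eq_getElem _ _ hk1,
      List.getElem_map]
  have hbm : bs.getD (k - 1) (0, []) ∈ bs := by
    rw [List.getD_eq_getElem _ _ hk1]; exact List.getElem_mem _
  rw [hget] at hhead hsplit
  rw [← List.map_take] at hbefore hsplit
  rw [← List.map_drop] at hafter hsplit
  have htot : total bs = total (bs.take k) + total (bs.drop k) := by
    rw [← total_append, List.take_append_drop]
  have htake := take_succ_getD bs (0, []) hk1
  rw [Nat.sub_add_cancel hk0] at htake
  have hin : ∀ q : Bucket, q ∈ bs → q.2 ∈ bs.map (·.2) := fun q hq => List.mem_map_of_mem hq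
  generalize bs.getD (k - 1) (0, []) = b at *
  have hpre : (pre.map (·.2)).flatten.countP p = total pre := by
    rw [total_eq_length_flatten]
    refine List.countP_eq_length.2 fun x hx => ?_
    obtain ⟨c, hc, hx⟩ := List.mem_flatten.1 hx
    exact hp _ _ (o1.2.2 c hc b.2 (List.mem_append_left _ (hin b hbm)) x hx _
      (headD_mem (hbs.ne_nil b.2 (hin b hbm)))) hhead
  have hbefore' : ((bs.take (k - 1)).map (·.2)).flatten.countP p = total (bs.take (k - 1)) := by
    rw [total_eq_length_flatten]
    refine List.countP_eq_length.2 fun x hx => ?_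
    obtain ⟨c, hc, hx⟩ := List.mem_flatten.1 hx
    exact hbefore c hc x hx
  have hafter' : ((bs.drop k).map (·.2)).flatten.countP p = 0 := by
    refine List.countP_eq_zero.2 fun x hx => ?_
    obtain ⟨c, hc, hx⟩ := List.mem_flatten.1 hx
    exact hafter c hc x hx
  have hb : 0 < b.2.countP p :=
    List.countP_pos_iff.2 ⟨_, headD_mem (hbs.ne_nil b.2 (hin b hbm)), hhead⟩
  have hb' : b.2.countP p ≤ b.2.length := List.countP_le_length
  have hbs' : (bs.map (·.2)).flatten.countP p = total (bs.take (k - 1)) + b.2.countP p := by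
    rw [hsplit, List.flatten_append, List.flatten_cons, List.countP_append, List.countP_append,
      hbefore', hafter']
    omega
  -- A bucket of `bs` after the chosen one has a failing head, which rules out passing elements in
  -- `post`. If there is none, the upper bound on `r` is the hypothesis `hr'`.
  have hpost0 : 0 < total (bs.drop k) → (post.map (·.2)).flatten.countP p = 0 := by
    intro h0
    refine List.countP_eq_zero.2 fun x hx hpx => ?_
    obtain ⟨c, hc, hx⟩ := List.mem_flatten.1 hx
    obtain ⟨d, hd⟩ : ∃ d, d ∈ bs.drop k := by
      by_contra hne
      push Not at hne
      rw [List.eq_nil_iff_forall_not_mem.2 hne] at h0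
      simp at h0
    have hd' := hin d (List.mem_of_mem_drop hd)
    have hdm := headD_mem (hbs.ne_nil d.2 hd')
    exact hafter d.2 (List.mem_map_of_mem hd) _ hdm
      (hp _ _ (o1.2.1.2.2 d.2 hd' c hc _ hdm x hx) hpx)
  refine Spec.ret ⟨by omega, ?_, ?_, by omega⟩
  · rw [total_append]; omega
  · rw [Nat.sub_add_cancel hk0, total_append]
    rw [htake, total_append, total_cons, total_nil] at htot ⊢
    rcases Nat.eq_zero_or_pos (total (bs.drop k)) with h0 | h0
    · omega
    · have := hpost0 h0
      omega

/-- The test of the overall minimum treats rank `0` separately, as no bucket corresponds to it.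
Otherwise the singleton reached is the last passing element, and its rank is the count. -/
theorem spec_rankOf (hv : Models mem n v) {test : ℕ → CompTree Bool} {p : ℕ → Bool}
    (ht : ∀ x < n, Spec mem (test x) fun b c => b = p x ∧ c ≤ 1)
    (hp : ∀ x y, v x ≤ v y → p y = true → p x = true) {bs : List Bucket}
    (h : Partition v n T bs)
    (hT : ∃ s ∈ T, Nat.dist ((List.range n).countP p) s ≤ 1) :
    Spec mem (rankOf test bs) fun o c => o.1 = (List.range n).countP p ∧ Partition v n T o.2 ∧
      c + potential bs ≤ potential o.2 + (5 * n.size + 4) := by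
  rcases hbs : bs with _ | ⟨b, bs'⟩
  · rw [hbs] at h
    have h0 : n = 0 := by simpa using h.total_eq.symm
    exact Spec.ret ⟨by simp [h0], h, by simp⟩
  unfold rankOf
  have hbm : b ∈ bs := by simp [hbs]
  have hhead := headD_mem (h.ne_nil hbm)
  have hmem : (b.2.headD 0) ∈ List.range n := List.mem_range.2 (h.lt_of_mem hbm hhead)
  refine (ht _ (List.mem_range.1 hmem)).bind ?_
  rintro _ c₁ ⟨rfl, hc₁⟩
  rw [← hbs]
  obtain ⟨s, hs, hrs⟩ := hT
  split
  · rename_i hpb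
    refine (spec_locate hv (guides_pickTest ht hp) hs hrs h
      (List.countP_pos_iff.2 ⟨_, hmem, hpb⟩)
      (by simpa using List.countP_le_length (p := p) (l := List.range n))).bind ?_
    rintro o c₂ ⟨g1, g2, g3, g4⟩
    exact Spec.ret ⟨g3, g1, by simp only; omega⟩
  · rename_i hpb
    refine Spec.ret ⟨?_, h, by simp only; omega⟩
    symm
    refine List.countP_eq_zero.2 fun x hx hpx => hpb (hp _ _ ?_ hpx)
    obtain ⟨c, hc, hxc⟩ := List.mem_flatten.1 (h.perm.symm.subset hx)
    have hord := h.ordered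
    rw [hbs, List.map_cons] at hord hc
    rcases List.mem_cons.1 hc with rfl | hc
    · exact (hord.headMin b.2 (by simp)).headD hxc
    · exact (List.pairwise_cons.1 hord.below).1 c hc _ hhead x hxc

end

/-! ### The data structure -/

/-- The state of the data structure: the size of the memory, the partition of the original
addresses, the current array in sorted order, where `inl r` stands for the `r`-th smallest original
element and `inr x` for the inserted element at address `x`, and the number of entries smaller than
the element searched for last. -/
structure ArrayState where
  size : ℕ
  buckets : List Bucket
  entries : List (ℕ ⊕ ℕ)
  smaller : ℕ

/-- The addresses of the inserted elements in sorted order. -/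
def inserted (es : List (ℕ ⊕ ℕ)) : List ℕ := es.filterMap Sum.getRight?

/-- The number of original entries whose rank is at most `k`. -/
def countOriginal (k : ℕ) (es : List (ℕ ⊕ ℕ)) : ℕ :=
  es.countP fun e => e.elim (fun r => decide (r ≤ k)) fun _ => false

/-- Test whether an element is smaller than the one at address `a`. -/
def testLT (a x : ℕ) : CompTree Bool := (ask a x).bind fun b => .ret !b

/-- Test whether an element is at most the one at address `a`. -/
def testLE (a x : ℕ) : CompTree Bool := ask x a

/-- Procedure for a search. -/
def searchProc (s : ArrayState) : CompTree (ArrayState × Bool × ℕ) :=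
  let ins := inserted s.entries
  (rankOf (testLT s.size) s.buckets).bind fun o₁ => (rankOf (testLE s.size) o₁.2).bind fun o₂ =>
    (bsearch (testLT s.size) ins.length.size ins).bind fun k₁ =>
      (bsearch (testLE s.size) ins.length.size ins).bind fun k₂ =>
        let lt := countOriginal o₁.1 s.entries + k₁
        let le := countOriginal o₂.1 s.entries + k₂
        .ret (⟨s.size + 1, o₂.2, s.entries, lt⟩, decide (lt < le), lt + if lt < le then 1 else 0)

/-- Procedure for a selection. -/
def selectProc (s : ArrayState) (i : ℕ) : CompTree (ArrayState × ℕ) :=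
  match s.entries[i - 1]? with
  | some (.inl r) => (locate (pickRank r) s.buckets).bind fun o =>
      .ret ({ s with buckets := o.1 ++ o.2.1 :: o.2.2 }, o.2.1.2.headD 0)
  | some (.inr x) => .ret (s, x)
  | none => .ret (s, 0)

/-- The data structure for dynamic multiselection. -/
def multiselect : OnlineStructure where
  State := ArrayState
  init n := (moveMin (List.range n)).bind fun l =>
    .ret ⟨n, if l = [] then [] else [(0, l)], (List.range n).map fun i => .inl (i + 1), 0⟩
  select := selectProc
  search := searchProc
  insert s := .ret { s with
    size := s.size + 1
    entries := s.entries.take s.smaller ++ .inr s.size :: s.entries.drop s.smaller }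
  delete s i := .ret { s with entries := s.entries.eraseIdx (i - 1) }

section

variable {α : Type*} {A mem : List α}

/-- The value at an address. -/
def val (mem : List α) (i : ℕ) : WithBot α := (mem[i]?).elim ⊥ (↑)

theorem val_eq_coe {i : ℕ} {x : α} (h : mem[i]? = some x) : val mem i = x := by
  simp [val, h]

theorem getElem?_eq_of_prefixed (h : A <+: mem) {i : ℕ} (hi : i < A.length) : mem[i]? = A[i]? := by
  obtain ⟨rest, rfl⟩ := h
  exact List.getElem?_append_left hi

theorem range_countP_all (A : List α) (q : α → Bool) :
    (List.range A.length).countP (fun x => (A[x]?).all q) = A.countP q := by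
  have h : (List.range A.length).map (A[·]?) = A.map some := by
    apply List.ext_getElem <;> simp
  have := congrArg (List.countP (Option.all q)) h
  rw [List.countP_map, List.countP_map] at this
  exact this

end

/-! ### Ties, ranks and the invariant of the state -/

section

variable {α : Type*} [LinearOrder α]

/-- The `s`-th smallest element of the array is followed by the elements equal to it; this is the
last position of such an element. -/
def lastPos (A : List α) (s : ℕ) : ℕ :=
  match (A.insertionSort (· ≤ ·))[s - 1]? with
  | some x => A.countP fun y => decide (y ≤ x)
  | none => s

/-- The positions at which the partition may be refined. -/
def targets (A : List α) (S : List ℕ) : Set ℕ := {t | t ∈ S ∨ ∃ s ∈ S, t = lastPos A s}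

/-- How an entry is represented. -/
def Represents (A mem : List α) : ℕ ⊕ ℕ → Entry α → Prop
  | .inl r, e => e.pos = r ∧ 1 ≤ r ∧ (A.insertionSort (· ≤ ·))[r - 1]? = some e.value
  | .inr x, e => mem[x]? = some e.value

/-- The invariant of the data structure. -/
structure StateInv (A : List α) (T : Set ℕ) (mem : List α) (L : List (Entry α))
    (s : ArrayState) : Prop where
  prefix_mem : A <+: mem
  size : s.size = mem.length
  partition : Partition (val A) A.length T s.buckets
  entries : List.Forall₂ (Represents A mem) s.entries L
  sorted : L.Pairwise fun e e' => e.value ≤ e'.value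

variable {A mem : List α} {T : Set ℕ} {L : List (Entry α)} {s : ArrayState}

theorem leAt_eq {i j : ℕ} {x y : α} (hi : mem[i]? = some x) (hj : mem[j]? = some y) :
    leAt mem i j = decide (x ≤ y) := by
  simp [leAt, hi, hj]

theorem models_val (h : A <+: mem) : Models mem A.length (val A) := by
  intro i hi j hj
  have h1 := List.getElem?_eq_getElem hi
  have h2 := List.getElem?_eq_getElem hj
  rw [leAt_eq ((getElem?_eq_of_prefixed h hi).trans h1) ((getElem?_eq_of_prefixed h hj).trans h2),
    val_eq_coe h1, val_eq_coe h2]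
  simp

theorem pairwise_sorted (A : List α) : (A.insertionSort (· ≤ ·)).Pairwise (· ≤ ·) :=
  List.pairwise_insertionSort _ A

theorem countP_sorted (A : List α) (q : α → Bool) :
    (A.insertionSort (· ≤ ·)).countP q = A.countP q :=
  (List.perm_insertionSort _ A).countP_eq q

theorem iff_lt_countP {ι : Type*} {p : ι → Bool} {l : List ι}
    (hl : l.Pairwise fun x y => p y = true → p x = true) {k : ℕ} {x : ι} (hx : l[k]? = some x) :
    p x = true ↔ k < l.countP p := by
  obtain ⟨hk, rfl⟩ := List.getElem?_eq_some_iff.1 hx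
  obtain ⟨h1, h2⟩ := countP_splits p l hl
  constructor
  · intro h
    by_contra hlt
    exact h2 _ (List.mem_drop_iff_getElem.2 ⟨k - l.countP p, by omega, by
      congr 1; omega⟩) h
  · intro h
    exact h1 _ (List.mem_take_iff_getElem.2 ⟨k, by omega, rfl⟩)

theorem sorted_iff_lt_countP {q : α → Bool} (hq : ∀ x y, x ≤ y → q y = true → q x = true) {k : ℕ}
    {x : α} (hx : (A.insertionSort (· ≤ ·))[k]? = some x) : q x = true ↔ k < A.countP q := by
  rw [← countP_sorted A q]
  exact iff_lt_countP ((pairwise_sorted A).imp fun h => hq _ _ h) hx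

theorem lt_closed (a : α) : ∀ x y : α, x ≤ y → decide (y < a) = true → decide (x < a) = true := by
  intro x y hxy hy
  simp only [decide_eq_true_eq] at hy ⊢
  exact hxy.trans_lt hy

theorem le_closed (a : α) : ∀ x y : α, x ≤ y → decide (y ≤ a) = true → decide (x ≤ a) = true := by
  intro x y hxy hy
  simp only [decide_eq_true_eq] at hy ⊢
  exact hxy.trans hy

/-- The entry of the sorted array at an index is determined by counting. -/
theorem sorted_getElem?_eq {a : α} {k : ℕ} (h1 : A.countP (fun x => decide (x < a)) ≤ k)
    (h2 : k < A.countP (fun x => decide (x ≤ a))) : (A.insertionSort (· ≤ ·))[k]? = some a := by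
  have hk : k < (A.insertionSort (· ≤ ·)).length := by
    rw [List.length_insertionSort]
    exact h2.trans_le List.countP_le_length
  have hx := List.getElem?_eq_getElem hk
  have h3 := sorted_iff_lt_countP (lt_closed a) hx
  have h4 := sorted_iff_lt_countP (le_closed a) hx
  simp only [decide_eq_true_eq] at h3 h4
  rw [hx, le_antisymm (h4.2 h2) (not_lt.1 fun h => (h3.1 h).not_ge h1)]

theorem countP_le_eq (l : List α) (a : α) :
    l.countP (fun x => decide (x ≤ a)) = l.countP (fun x => decide (x < a)) + l.count a := by
  induction l with
  | nil => rfl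
  | cons x l ih =>
    rw [List.countP_cons, List.countP_cons, List.count_cons, ih]
    rcases lt_trichotomy x a with h | h | h
    · simp [h, h.le, h.ne]; omega
    · simp [h]; omega
    · simp [h.not_gt, h.not_ge, h.ne']

theorem countP_lt_countP_iff (l : List α) (a : α) :
    l.countP (fun x => decide (x < a)) < l.countP (fun x => decide (x ≤ a)) ↔ a ∈ l := by
  rw [countP_le_eq, ← List.count_pos_iff]
  omega

/-- Addresses outside `A` have value `⊥` and pass every `Option.all` test, so the closure property
holds for all addresses. -/
theorem all_closed {q : α → Bool} (hq : ∀ x y, x ≤ y → q y = true → q x = true) :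
    ∀ x y, val A x ≤ val A y → (A[y]?).all q = true → (A[x]?).all q = true := by
  intro x y hxy hy
  rcases hx' : A[x]? with _ | a
  · simp
  rcases hy' : A[y]? with _ | b
  · rw [val_eq_coe hx'] at hxy
    simp [val, hy'] at hxy
  · rw [val_eq_coe hx', val_eq_coe hy', WithBot.coe_le_coe] at hxy
    simp only [hy', Option.all_some] at hy ⊢
    exact hq a b hxy hy

/-- Ties prevent identifying an address with a rank, but the value is determined: at most `total
pre` elements are smaller than `y`, and more than that are at most `y`. -/
theorem Partition.sorted_getElem? {pre post : List Bucket} {b : Bucket} {x : ℕ} {y : α}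
    (h : Partition (val A) A.length T (pre ++ b :: post)) (hb : b.2 = [x]) (hx : A[x]? = some y) :
    (A.insertionSort (· ≤ ·))[total pre]? = some y := by
  have hcount : ∀ p : ℕ → Bool, (List.range A.length).countP p =
      (pre.map (·.2)).flatten.countP p + ([x].countP p + (post.map (·.2)).flatten.countP p) := by
    intro p
    rw [← h.perm.countP_eq]
    simp only [List.map_append, List.map_cons, List.flatten_append, List.flatten_cons,
      List.countP_append, hb]
  have hord := h.ordered.below
  rw [List.map_append, List.map_cons, List.pairwise_append, List.pairwise_cons, hb] at hord
  apply sorted_getElem?_eq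
  · rw [← range_countP_all, hcount]
    have h1 : [x].countP (fun i => (A[i]?).all fun z => decide (z < y)) = 0 := by simp [hx]
    have h2 : (post.map (·.2)).flatten.countP
        (fun i => (A[i]?).all fun z => decide (z < y)) = 0 := by
      refine List.countP_eq_zero.2 fun i hi hlt => ?_
      obtain ⟨c, hc, hic⟩ := List.mem_flatten.1 hi
      have := all_closed (lt_closed y) x i (hord.2.1.1 c hc x (by simp) i hic) hlt
      simp [hx] at this
    rw [h1, h2]
    simpa using countP_le_total
  · rw [← range_countP_all, hcount]
    have h1 : [x].countP (fun i => (A[i]?).all fun z => decide (z ≤ y)) = 1 := by simp [hx]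
    have h2 : (pre.map (·.2)).flatten.countP
        (fun i => (A[i]?).all fun z => decide (z ≤ y)) = total pre := by
      rw [total_eq_length_flatten]
      refine List.countP_eq_length.2 fun i hi => ?_
      obtain ⟨c, hc, hic⟩ := List.mem_flatten.1 hi
      exact all_closed (le_closed y) i x (hord.2.2 c hc [x] (by simp) i hic x (by simp))
        (by simp [hx])
    omega

theorem forall₂_getElem? {ι κ : Type*} {R : ι → κ → Prop} {l : List ι} {l' : List κ}
    (h : List.Forall₂ R l l') {k : ℕ} {y : κ} (hy : l'[k]? = some y) :
    ∃ x, l[k]? = some x ∧ R x y := by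
  obtain ⟨hk, rfl⟩ := List.getElem?_eq_some_iff.1 hy
  have hk' : k < l.length := h.length_eq ▸ hk
  exact ⟨l[k], List.getElem?_eq_getElem hk', h.get hk' hk⟩

theorem Represents.mono {mem' : List α} (h : mem <+: mem') {x : ℕ ⊕ ℕ} {e : Entry α}
    (hx : Represents A mem x e) : Represents A mem' x e := by
  cases x with
  | inl r => exact hx
  | inr x =>
    have hlt : x < mem.length := (List.getElem?_eq_some_iff.1 hx).1
    exact (getElem?_eq_of_prefixed h hlt).trans hx

theorem inserted_sublist {es : List (ℕ ⊕ ℕ)} (h : List.Forall₂ (Represents A mem) es L) :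
    ((inserted es).map (mem[·]?)).Sublist (L.map fun e => some e.value) := by
  induction h with
  | nil => exact .slnil
  | @cons x e es L hx _ ih =>
    cases x with
    | inl r => exact ih.cons _
    | inr x =>
      have hx : mem[x]? = some e.value := hx
      simp only [inserted, List.filterMap_cons, Sum.getRight?_inr, List.map_cons, hx]
      exact ih.cons_cons _

theorem lt_length_of_mem_inserted {es : List (ℕ ⊕ ℕ)}
    (h : List.Forall₂ (Represents A mem) es L) {x : ℕ} (hx : x ∈ inserted es) :
    x < mem.length := by
  have h1 := (inserted_sublist h).subset (List.mem_map_of_mem (f := (mem[·]?)) hx)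
  obtain ⟨e, -, he⟩ := List.mem_map.1 h1
  exact (List.getElem?_eq_some_iff.1 he.symm).1

theorem inserted_pairwise {es : List (ℕ ⊕ ℕ)} (h : List.Forall₂ (Represents A mem) es L)
    (hL : L.Pairwise fun e e' => e.value ≤ e'.value) {q : α → Bool}
    (hq : ∀ x y, x ≤ y → q y = true → q x = true) :
    (inserted es).Pairwise fun x y => (mem[y]?).all q = true → (mem[x]?).all q = true := by
  have h1 : (L.map fun e => some e.value).Pairwise fun x y => y.all q = true → x.all q = true := by
    rw [List.pairwise_map]
    exact hL.imp fun hxy => hq _ _ hxy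
  simpa only [List.pairwise_map] using h1.sublist (inserted_sublist h)

/-- An original entry of rank `r` passes exactly when `r` is at most the number of passing elements
of `A`. Hence one rank in the original array counts the surviving original entries without further
comparisons, whatever has been deleted. -/
theorem countP_entries {es : List (ℕ ⊕ ℕ)} (h : List.Forall₂ (Represents A mem) es L)
    {q : α → Bool} (hq : ∀ x y, x ≤ y → q y = true → q x = true) :
    countOriginal (A.countP q) es + (inserted es).countP (fun x => (mem[x]?).all q) =
      (L.map Entry.value).countP q := by
  induction h with
  | nil => rfl
  | @cons x e es L hx _ ih =>
    rw [List.map_cons, List.countP_cons, ← ih]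
    cases x with
    | inl r =>
      obtain ⟨-, hr, hx⟩ := hx
      have h1 : q e.value = true ↔ r ≤ A.countP q := by
        rw [sorted_iff_lt_countP hq hx]; omega
      simp only [countOriginal, List.countP_cons, Sum.elim_inl, inserted, List.filterMap_cons,
        Sum.getRight?_inl, decide_eq_true_eq, ← h1]
      omega
    | inr x =>
      have hx : mem[x]? = some e.value := hx
      simp only [countOriginal, List.countP_cons, Sum.elim_inr, inserted, List.filterMap_cons,
        Sum.getRight?_inr, hx, Option.all_some]
      simp
      omega

theorem spec_testLT {a : α} {x : ℕ} (hx : x < mem.length) :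
    Spec (mem ++ [a]) (testLT mem.length x) fun b c =>
      b = (mem[x]?).all (fun y => decide (y < a)) ∧ c ≤ 1 := by
  refine (spec_ask _ _).bind ?_
  rintro b c ⟨rfl, rfl⟩
  refine Spec.ret ⟨?_, by simp⟩
  have h1 : (mem ++ [a])[mem.length]? = some a := by simp
  have h2 := List.getElem?_eq_getElem hx
  rw [leAt_eq h1 ((List.getElem?_append_left hx).trans h2), h2]
  simp [← not_le]

theorem spec_testLE {a : α} {x : ℕ} (hx : x < mem.length) :
    Spec (mem ++ [a]) (testLE mem.length x) fun b c =>
      b = (mem[x]?).all (fun y => decide (y ≤ a)) ∧ c ≤ 1 := by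
  refine (spec_ask _ _).mono ?_
  rintro b c ⟨rfl, rfl⟩
  refine ⟨?_, by simp⟩
  have h1 : (mem ++ [a])[mem.length]? = some a := by simp
  have h2 := List.getElem?_eq_getElem hx
  rw [leAt_eq ((List.getElem?_append_left hx).trans h2) h1, h2]
  simp

theorem lastPos_of_mem {a : α} (ha : a ∈ A) :
    lastPos A (searchPos A a) = A.countP fun y => decide (y ≤ a) := by
  have h1 := sorted_getElem?_eq le_rfl ((countP_lt_countP_iff A a).2 ha)
  unfold lastPos searchPos
  rw [if_pos ha, Nat.add_sub_cancel, h1]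

/-- The number of smaller elements differs from the reported position by one exactly when `a`
occurs. The number of elements at most `a` is the last position of `a` if it occurs, and the
reported position otherwise. -/
theorem near_targets {S : List ℕ} {a : α} (h : searchPos A a ∈ S) :
    (∃ s ∈ targets A S, Nat.dist (A.countP fun x => decide (x < a)) s ≤ 1) ∧
      ∃ s ∈ targets A S, Nat.dist (A.countP fun x => decide (x ≤ a)) s ≤ 1 := by
  refine ⟨⟨_, .inl h, ?_⟩, ?_⟩
  · unfold searchPos Nat.dist
    split <;> omega
  · by_cases ha : a ∈ A
    · exact ⟨_, .inr ⟨_, h, rfl⟩, by rw [lastPos_of_mem ha, Nat.dist_self]; omega⟩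
    · refine ⟨_, .inl h, ?_⟩
      rw [countP_le_eq, List.count_eq_zero.2 ha, searchPos, if_neg ha, Nat.dist_self]
      omega

theorem spec_searchProc {S : List ℕ} (h : StateInv A (targets A S) mem L s) {a : α}
    (ha : searchPos A a ∈ S) :
    Spec (mem ++ [a]) (searchProc s) fun o c =>
      StateInv A (targets A S) (mem ++ [a]) L o.1 ∧
      o.1.smaller = (L.map Entry.value).countP (fun x => decide (x < a)) ∧
      o.2.1 = decide (a ∈ L.map Entry.value) ∧ o.2.2 = searchPos (L.map Entry.value) a ∧
      o.1.entries = s.entries ∧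
      c + potential s.buckets ≤ potential o.1.buckets +
        (10 * A.length.size + 8 + 2 * (inserted s.entries).length.size) := by
  obtain ⟨hpre, hsize, hpart, hent, hsort⟩ := h
  have hpre' : A <+: mem ++ [a] := hpre.trans (List.prefix_append _ _)
  have hv := models_val hpre'
  obtain ⟨hT₁, hT₂⟩ := near_targets ha
  rw [← range_countP_all] at hT₁ hT₂
  have hlen := hpre.length_le
  have hget : ∀ x < A.length, mem[x]? = A[x]? := fun x hx => getElem?_eq_of_prefixed hpre hx
  unfold searchProc
  rw [hsize]
  refine (spec_rankOf hv (fun x hx => hget x hx ▸ spec_testLT (by omega))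
    (all_closed (lt_closed a)) hpart hT₁).bind ?_
  rintro o₁ c₁ ⟨hr₁, hp₁, hc₁⟩
  refine (spec_rankOf hv (fun x hx => hget x hx ▸ spec_testLE (by omega))
    (all_closed (le_closed a)) hp₁ hT₂).bind ?_
  rintro o₂ c₂ ⟨hr₂, hp₂, hc₂⟩
  refine (spec_bsearch _ _ (fun x hx => spec_testLT (lt_length_of_mem_inserted hent hx))
    (inserted_pairwise hent hsort (lt_closed a)) (Nat.lt_size_self _)).bind ?_
  rintro k₁ c₃ ⟨rfl, hc₃⟩
  refine (spec_bsearch _ _ (fun x hx => spec_testLE (lt_length_of_mem_inserted hent hx))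
    (inserted_pairwise hent hsort (le_closed a)) (Nat.lt_size_self _)).bind ?_
  rintro k₂ c₄ ⟨rfl, hc₄⟩
  rw [range_countP_all] at hr₁ hr₂
  rw [hr₁, hr₂, countP_entries hent (lt_closed a), countP_entries hent (le_closed a)]
  simp only [countP_lt_countP_iff]
  refine Spec.ret ⟨⟨hpre', by simp, hp₂, hent.imp fun _ _ hx =>
    hx.mono (List.prefix_append _ _), hsort⟩, rfl, rfl, rfl, rfl, ?_⟩
  simp only
  omega

/-- An original entry is stored as a rank; the address found for it may hold another entry of equal
value, which is enough for the answer. An inserted entry is stored by address and needs no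
comparison. -/
theorem spec_selectProc {S : List ℕ} (h : StateInv A (targets A S) mem L s) {i : ℕ} {e : Entry α}
    (he : L[i - 1]? = some e) (hS : e.pos ∈ S) :
    Spec mem (selectProc s i) fun o c =>
      StateInv A (targets A S) mem L o.1 ∧ mem[o.2]? = some e.value ∧
      o.1.entries = s.entries ∧ c + potential s.buckets ≤ potential o.1.buckets := by
  obtain ⟨x, hx, hrep⟩ := forall₂_getElem? h.entries he
  unfold selectProc
  rw [hx]
  cases x with
  | inr x => exact Spec.ret ⟨h, hrep, rfl, by simp⟩
  | inl r =>
    obtain ⟨hpos, hr, hval⟩ := hrep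
    have hrn : r ≤ A.length := by
      have := (List.getElem?_eq_some_iff.1 hval).1
      rw [List.length_insertionSort] at this
      omega
    refine (spec_locate (models_val h.prefix_mem) (guides_pickRank r) (s := r)
      (.inl (hpos ▸ hS)) (by simp [Nat.dist_self]) h.partition hr hrn).bind ?_
    rintro ⟨pre, b, post⟩ c ⟨g1, g2, g3, g4⟩
    simp only at g1 g2 g3 g4
    obtain ⟨y, hy⟩ := List.length_eq_one_iff.1 g2
    have hyA : y < A.length := g1.lt_of_mem (b := b) (by simp) (by simp [hy])
    have hAy := List.getElem?_eq_getElem hyA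
    have hsorted := g1.sorted_getElem? hy hAy
    refine Spec.ret ⟨⟨h.prefix_mem, h.size, g1, h.entries, h.sorted⟩, ?_, rfl, by
      simp only; omega⟩
    simp only [hy, List.headD_cons]
    rw [getElem?_eq_of_prefixed h.prefix_mem hyA, hAy, ← hsorted, ← hval]
    congr 1
    omega

end

/-! ### Correctness and potential of a run -/

section

variable {α : Type*} [LinearOrder α] {A mem : List α} {T : Set ℕ} {L : List (Entry α)}
  {s : ArrayState}

theorem takeWhile_eq_take_countP {ι : Type*} {p : ι → Bool} {l : List ι}
    (hl : l.Pairwise fun x y => p y = true → p x = true) :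
    l.takeWhile p = l.take (l.countP p) ∧ l.dropWhile p = l.drop (l.countP p) := by
  induction l with
  | nil => simp
  | cons x l ih =>
    rw [List.pairwise_cons] at hl
    by_cases hx : p x = true
    · simp [hx, ih hl.2]
    · have : l.countP p = 0 := List.countP_eq_zero.2 fun y hy hpy => hx (hl.1 y hy hpy)
      simp [hx, this]

theorem length_inserted_append (es es' : List (ℕ ⊕ ℕ)) :
    (inserted (es ++ es')).length = (inserted es).length + (inserted es').length := by
  simp [inserted, List.filterMap_append]

/-- The remembered count is the length of the prefix of smaller entries, so the place of the new
entry is known without a comparison. -/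
theorem StateInv.insert (h : StateInv A T mem L s) {a : α}
    (ha : s.smaller = (L.map Entry.value).countP fun x => decide (x < a)) :
    StateInv A T (mem ++ [a]) (applyOp A L (.insert a)) { s with
      size := s.size + 1
      entries := s.entries.take s.smaller ++ .inr s.size :: s.entries.drop s.smaller } := by
  obtain ⟨hpre, hsize, hpart, hent, hsort⟩ := h
  have hmono : L.Pairwise fun e e' => decide (e'.value < a) = true → decide (e.value < a) = true :=
    hsort.imp fun h => lt_closed a _ _ h
  rw [List.countP_map] at ha
  obtain ⟨h1, h2⟩ := takeWhile_eq_take_countP (p := fun e : Entry α => decide (e.value < a)) hmono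
  obtain ⟨h3, h4⟩ := countP_splits (fun e : Entry α => decide (e.value < a)) L hmono
  change s.smaller = L.countP (fun e : Entry α => decide (e.value < a)) at ha
  rw [← ha] at h1 h2 h3 h4
  refine ⟨hpre.trans (List.prefix_append _ _), by simp [hsize], hpart, ?_, ?_⟩
  · simp only [applyOp, h1, h2]
    have hent' : List.Forall₂ (Represents A (mem ++ [a])) s.entries L :=
      hent.imp fun _ _ hx => hx.mono (List.prefix_append _ _)
    refine List.rel_append (List.forall₂_take _ hent') (.cons ?_ (List.forall₂_drop _ hent'))
    simp [Represents, hsize]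
  · simp only [applyOp, h1, h2]
    have hs := hsort
    rw [← List.take_append_drop s.smaller L, List.pairwise_append] at hs
    simp only [decide_eq_true_eq, not_lt] at h3 h4
    rw [List.pairwise_append, List.pairwise_cons]
    refine ⟨hs.1, ⟨h4, hs.2.1⟩, ?_⟩
    intro e he e' he'
    rcases List.mem_cons.1 he' with rfl | he'
    · exact (h3 e he).le
    · exact hs.2.2 e he e' he'

theorem StateInv.delete (h : StateInv A T mem L s) (i : ℕ) :
    StateInv A T mem (applyOp A L (.delete i)) { s with
      entries := s.entries.eraseIdx (i - 1) } := by
  obtain ⟨hpre, hsize, hpart, hent, hsort⟩ := h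
  refine ⟨hpre, hsize, hpart, ?_, hsort.sublist (List.eraseIdx_sublist _ _)⟩
  simp only [applyOp, List.eraseIdx_eq_take_drop_succ]
  exact List.rel_append (List.forall₂_take _ hent) (List.forall₂_drop _ hent)

/-- The state remembers the number of entries smaller than the element searched for by the
previous operation. -/
def Remembers (prev : Option (Op α)) (L : List (Entry α)) (s : ArrayState) : Prop :=
  ∀ a, prev = some (.search a) →
    s.smaller = (L.map Entry.value).countP fun x => decide (x < a)

/-- The bound for the comparisons of an operation that are not paid by the potential. -/
def opBudget (n X : ℕ) (o : Op α) : ℕ :=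
  if o.nonSelect then 10 * n.size + 8 + 2 * X.size else 0

theorem step_spec {S : List ℕ} (h : StateInv A (targets A S) mem L s) {prev : Option (Op α)}
    (hrem : Remembers prev L s) {o : Op α} (ho : Admissible prev L o)
    (hS : ∀ q ∈ queryPos A L o, q ∈ S) {X : ℕ} (hX : (inserted s.entries).length ≤ X) :
    (multiselect.step s mem o).answer = expectedAnswer L o ∧
    StateInv A (targets A S) (multiselect.step s mem o).mem (applyOp A L o)
      (multiselect.step s mem o).state ∧
    Remembers (some o) (applyOp A L o) (multiselect.step s mem o).state ∧
    (inserted (ArrayState.entries (multiselect.step s mem o).state)).length ≤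
      (inserted s.entries).length + 1 ∧
    (multiselect.step s mem o).cost + potential s.buckets ≤
      potential (ArrayState.buckets (multiselect.step s mem o).state) + opBudget A.length X o := by
  cases o with
  | select i =>
    obtain ⟨e, he⟩ : ∃ e, L[i - 1]? = some e := by
      have h1 : 1 ≤ i ∧ i ≤ L.length := ho
      exact ⟨_, List.getElem?_eq_getElem (by omega : i - 1 < L.length)⟩
    obtain ⟨g1, g2, g3, g4⟩ := spec_selectProc h he (hS _ (by simp [queryPos, he]))
    refine ⟨?_, g1, by simp [Remembers], ?_, ?_⟩
    · simp only [OnlineStructure.step, expectedAnswer, List.getElem?_map, he, Option.map_some]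
      exact congrArg Answer.element g2
    · exact (congrArg (fun es => (inserted es).length) g3).le.trans (Nat.le_succ _)
    · exact g4.trans (Nat.le_add_right _ _)
  | search a =>
    obtain ⟨g1, g2, g3, g4, g5, g6⟩ := spec_searchProc h (a := a) (hS _ (by simp [queryPos]))
    refine ⟨?_, g1, ?_, ?_, ?_⟩
    · exact congrArg₂ Answer.position g3 g4
    · intro b hb
      obtain rfl : a = b := by simpa using hb
      exact g2
    · exact (congrArg (fun es => (inserted es).length) g5).le.trans (Nat.le_succ _)
    · refine g6.trans (Nat.add_le_add_left ?_ _)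
      have := Nat.size_le_size hX
      simp only [opBudget, Op.nonSelect, if_true]
      omega
  | insert a =>
    refine ⟨rfl, h.insert (hrem a ho), by simp [Remembers], ?_, ?_⟩
    · change (inserted (s.entries.take s.smaller ++ .inr s.size :: s.entries.drop s.smaller)).length
        ≤ _
      have h1 : inserted (.inr s.size :: s.entries.drop s.smaller) =
          s.size :: inserted (s.entries.drop s.smaller) := rfl
      rw [length_inserted_append, h1, List.length_cons, ← Nat.add_assoc, ← length_inserted_append,
        List.take_append_drop]
    · change 0 + potential s.buckets ≤ potential s.buckets + _
      omega
  | delete i =>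
    refine ⟨rfl, h.delete i, by simp [Remembers], ?_, ?_⟩
    · refine le_trans ?_ (Nat.le_succ _)
      exact ((List.eraseIdx_sublist s.entries (i - 1)).filterMap _).length_le
    · change 0 + potential s.buckets ≤ potential s.buckets + _
      omega

/-- `S` may contain all positions of the whole run: it occurs only in the invariant, never in the
procedures, so using future queries in the analysis does not affect the online character. -/
theorem run_spec {S : List ℕ} {X : ℕ} (ops : List (Op α)) {prev : Option (Op α)}
    (h : StateInv A (targets A S) mem L s) (hrem : Remembers prev L s)
    (hvalid : ValidFrom A prev L ops) (hS : ∀ q ∈ queriesFrom A L ops, q ∈ S)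
    (hX : (inserted s.entries).length + ops.length ≤ X) :
    multiselect.answersFrom s mem ops = expectedFrom A L ops ∧
    ∃ bs, Partition (val A) A.length (targets A S) bs ∧
      multiselect.costFrom s mem ops + potential s.buckets ≤
        potential bs + ops.countP Op.nonSelect * (10 * A.length.size + 8 + 2 * X.size) := by
  induction ops generalizing prev mem L s with
  | nil =>
    refine ⟨rfl, s.buckets, h.partition, ?_⟩
    change 0 + potential s.buckets ≤ _
    omega
  | cons o ops ih =>
    rw [List.length_cons] at hX
    have hS' : ∀ q, q ∈ queryPos A L o ∨ q ∈ queriesFrom A (applyOp A L o) ops → q ∈ S :=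
      fun q hq => hS q (List.mem_append.2 hq)
    obtain ⟨g1, g2, g3, g4, g5⟩ := step_spec h hrem hvalid.1 (fun q hq => hS' q (.inl hq))
      (by omega : (inserted s.entries).length ≤ X)
    obtain ⟨i1, bs, i2, i3⟩ := ih g2 g3 hvalid.2 (fun q hq => hS' q (.inr hq)) (by omega)
    refine ⟨?_, bs, i2, ?_⟩
    · simp only [OnlineStructure.answersFrom, expectedFrom, g1]
      exact congrArg _ i1
    · simp only [OnlineStructure.costFrom, List.countP_cons, add_mul]
      unfold opBudget at g5
      split at g5 <;> simp_all <;> omega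

theorem initEntries_represented (A : List α) : List.Forall₂ (Represents A A)
    ((List.range A.length).map fun i => .inl (i + 1)) (initEntries A) := by
  rw [List.forall₂_iff_get]
  refine ⟨by simp [initEntries], fun i h1 h2 => ?_⟩
  simp [initEntries, Represents, Nat.add_comm]

theorem initEntries_sorted (A : List α) :
    (initEntries A).Pairwise fun e e' => e.value ≤ e'.value := by
  have h : (initEntries A).map Entry.value = A.insertionSort (· ≤ ·) := by
    simp [initEntries, List.map_map, Function.comp_def]
  have := pairwise_sorted A
  rwa [← h, List.pairwise_map] at this

theorem init_spec (A : List α) (T : Set ℕ) :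
    Spec A (multiselect.init A.length) fun s c => StateInv A T A (initEntries A) s ∧
      inserted (ArrayState.entries s) = [] ∧ potential (ArrayState.buckets s) = 0 ∧
      c ≤ A.length := by
  refine (spec_moveMin (models_val (List.prefix_refl A)) (List.range A.length)
    fun x hx => List.mem_range.1 hx).bind ?_
  rintro l c ⟨hp, hm, hc⟩
  have hlen := hp.length_eq
  rw [List.length_range] at hlen hc
  refine Spec.ret ⟨⟨List.prefix_refl A, rfl, ?_, initEntries_represented A,
    initEntries_sorted A⟩, ?_, ?_, hc⟩
  · simp only
    split
    · rename_i h0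
      rw [h0] at hp
      exact ⟨by simpa using hp, ⟨by simp, by simp, by simp⟩, by simp, by simp [levels]⟩
    · rename_i h0
      refine ⟨by simpa using hp, ⟨by simp, by simpa using h0, by simpa using hm⟩, ?_, ?_⟩
      · simp [depth, hlen]
      · intro k j hk
        simp [levels, List.getElem?_replicate] at hk
  · simp [inserted, List.filterMap_map, Function.comp_def]
  · simp only
    split <;> simp [potential, levels, weight]

theorem multiselect_run (A : List α) (ops : List (Op α)) (h : Valid A ops) :
    multiselect.answers A ops = expectedAnswers A ops ∧
    ∃ bs, Partition (val A) A.length (targets A (queries A ops)) bs ∧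
      multiselect.cost A ops ≤ A.length + potential bs +
        ops.countP Op.nonSelect * (10 * A.length.size + 8 + 2 * ops.length.size) := by
  obtain ⟨g1, g2, g3, g4⟩ := init_spec A (targets A (queries A ops))
  obtain ⟨i1, bs, i2, i3⟩ := run_spec (X := ops.length) ops g1 (prev := none)
    (by simp [Remembers]) h (fun q hq => hq) (by rw [g2]; simp)
  refine ⟨i1, bs, i2, ?_⟩
  rw [g3] at i3
  unfold OnlineStructure.cost
  omega

end

/-! ### The information-theoretic bound -/

theorem logb_two_factorial_succ (k : ℕ) :
    Real.logb 2 ((k + 1).factorial : ℝ) =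
      Real.logb 2 ((k : ℝ) + 1) + Real.logb 2 (k.factorial : ℝ) := by
  rw [Nat.factorial_succ, Nat.cast_mul, Real.logb_mul (by positivity) (by positivity)]
  simp

theorem logb_two_factorial_eq_sum (k : ℕ) :
    Real.logb 2 (k.factorial : ℝ) = ∑ i ∈ Finset.range k, Real.logb 2 ((i : ℝ) + 1) := by
  induction k with
  | zero => simp
  | succ k ih => rw [logb_two_factorial_succ, Finset.sum_range_succ, ih, add_comm]

theorem logb_two_le (k : ℕ) : Real.logb 2 (k : ℝ) ≤ k := by
  rcases Nat.eq_zero_or_pos k with rfl | hk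
  · simp
  rw [Real.logb_le_iff_le_rpow (by norm_num) (by positivity), Real.rpow_natCast]
  exact_mod_cast (Nat.lt_two_pow_self).le

/-- This is `n ^ n / n! ≤ e ^ n ≤ 4 ^ n`. -/
theorem mul_logb_two_le (n : ℕ) :
    n * Real.logb 2 (n : ℝ) ≤ Real.logb 2 (n.factorial : ℝ) + 2 * n := by
  rcases Nat.eq_zero_or_pos n with rfl | hn
  · simp
  have h1 : (n : ℝ) ^ n / n.factorial ≤ Real.exp n :=
    Real.pow_div_factorial_le_exp n (by positivity) n
  have h2 : Real.exp n ≤ (4 : ℝ) ^ n := by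
    rw [← mul_one (n : ℝ), Real.exp_nat_mul]
    exact pow_le_pow_left₀ (Real.exp_pos 1).le (by linarith [Real.exp_one_lt_d9]) n
  have h3 : (n : ℝ) ^ n ≤ n.factorial * 4 ^ n := by
    rw [div_le_iff₀ (by positivity)] at h1
    nlinarith [h1, h2, (by positivity : (0 : ℝ) < n.factorial)]
  have h4 := Real.logb_le_logb_of_le (b := 2) (by norm_num) (by positivity) h3
  rw [Real.logb_mul (by positivity) (by positivity), Real.logb_pow, Real.logb_pow,
    (by norm_num : (4 : ℝ) = 2 ^ 2), Real.logb_pow] at h4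
  simp at h4
  linarith

/-- For a gap of length `k + 1`, the inequality `min x z ≥ x * z / (x + z)` with `x + z = k + 1`
bounds the product of the first `k` distances below by `(k!) ^ 2 / (k + 1) ^ k`. Then `(k + 1) ^ (k
+ 1)` is compared with `(k + 1)!`. -/
theorem sum_le_of_gap {a b N : ℕ} (hab : a ≤ b) {y : ℕ → ℕ}
    (hy : ∀ k, a ≤ k → k < b → max 1 (min (k + 1 - a) (b - (k + 1))) * 2 ^ y k ≤ N) :
    ∑ k ∈ Finset.Ico a b, (y k : ℝ) ≤ ((b - a : ℕ) : ℝ) * Real.logb 2 N -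
      Real.logb 2 ((b - a).factorial : ℝ) + 3 * ((b - a : ℕ) : ℝ) := by
  rw [Finset.sum_Ico_eq_sum_range]
  obtain ⟨d, rfl⟩ := Nat.exists_eq_add_of_le hab
  rw [Nat.add_sub_cancel_left]
  rcases d with _ | k
  · simp
  have hlog : ∀ i m : ℕ, 0 < m → m * 2 ^ y (a + i) ≤ N →
      (y (a + i) : ℝ) ≤ Real.logb 2 N - Real.logb 2 m := by
    intro i m hm h
    have h1 : ((m : ℝ) * 2 ^ y (a + i)) ≤ N := by exact_mod_cast h
    have h2 := Real.logb_le_logb_of_le (b := 2) (by norm_num) (by positivity) h1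
    rw [Real.logb_mul (by positivity) (by positivity), Real.logb_pow,
      Real.logb_self_eq_one (by norm_num)] at h2
    linarith
  -- The last rank is the right end itself, at distance `0`; here only the factor `max 1 _` is left.
  have hlast : (y (a + k) : ℝ) ≤ Real.logb 2 N := by
    have := hlog k 1 one_pos ((Nat.mul_le_mul_right _ (le_max_left _ _)).trans
      (hy (a + k) (by omega) (by omega)))
    simpa using this
  have hterm : ∀ i ∈ Finset.range k, (y (a + i) : ℝ) ≤ Real.logb 2 N -
      (Real.logb 2 ((i : ℝ) + 1) + Real.logb 2 (((k - 1 - i : ℕ) : ℝ) + 1) -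
        Real.logb 2 ((k : ℝ) + 1)) := by
    intro i hi
    rw [Finset.mem_range] at hi
    set m := min (i + 1) (k - i) with hm
    have hm0 : 0 < m := by omega
    have h1 := hlog i m hm0 ((Nat.mul_le_mul_right _ (by omega)).trans
      (hy (a + i) (by omega) (by omega)))
    have h2 : (i + 1) * (k - 1 - i + 1) ≤ m * (k + 1) := by
      have e : k - 1 - i + 1 = k - i := by omega
      rw [e]
      rcases le_total (i + 1) (k - i) with h | h
      · rw [hm, min_eq_left h]
        exact Nat.mul_le_mul_left _ (by omega)
      · rw [hm, min_eq_right h, mul_comm]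
        exact Nat.mul_le_mul_left _ (by omega)
    have h3 : ((i : ℝ) + 1) * (((k - 1 - i : ℕ) : ℝ) + 1) ≤ m * ((k : ℝ) + 1) := by
      exact_mod_cast h2
    have h4 := Real.logb_le_logb_of_le (b := 2) (by norm_num) (by positivity) h3
    rw [Real.logb_mul (by positivity) (by positivity),
      Real.logb_mul (by positivity) (by positivity)] at h4
    linarith
  rw [Finset.sum_range_succ]
  have hsum := Finset.sum_le_sum hterm
  rw [Finset.sum_sub_distrib, Finset.sum_sub_distrib, Finset.sum_add_distrib,
    Finset.sum_range_reflect (fun i : ℕ => Real.logb 2 ((i : ℝ) + 1)) k,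
    ← logb_two_factorial_eq_sum, Finset.sum_const, Finset.sum_const, Finset.card_range,
    nsmul_eq_mul, nsmul_eq_mul] at hsum
  have h5 := mul_logb_two_le (k + 1)
  have h6 := logb_two_le (k + 1)
  rw [logb_two_factorial_succ] at h5 ⊢
  push_cast at h5 h6 ⊢
  linarith

/-- The extra point costs one more unit per element because the binomial coefficient `(d + e)! / (d!
* e!)` is at most `2 ^ (d + e)`. -/
theorem sum_le_of_split_gap {a u b N : ℕ} (hau : a ≤ u) (hub : u ≤ b) {y : ℕ → ℕ}
    (h₁ : ∀ k, a ≤ k → k < u → max 1 (min (k + 1 - a) (u - (k + 1))) * 2 ^ y k ≤ N)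
    (h₂ : ∀ k, u ≤ k → k < b → max 1 (min (k + 1 - u) (b - (k + 1))) * 2 ^ y k ≤ N) :
    ∑ k ∈ Finset.Ico a b, (y k : ℝ) ≤ ((b - a : ℕ) : ℝ) * Real.logb 2 N -
      Real.logb 2 ((b - a).factorial : ℝ) + 4 * ((b - a : ℕ) : ℝ) := by
  have g₁ := sum_le_of_gap hau h₁
  have g₂ := sum_le_of_gap hub h₂
  rw [← Finset.sum_Ico_consecutive _ hau hub]
  obtain ⟨d, rfl⟩ := Nat.exists_eq_add_of_le hau
  obtain ⟨e, rfl⟩ := Nat.exists_eq_add_of_le hub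
  have e1 : a + d - a = d := by omega
  have e2 : a + d + e - (a + d) = e := by omega
  have e3 : a + d + e - a = d + e := by omega
  rw [e1] at g₁
  rw [e2] at g₂
  rw [e3]
  have h3 : ((d + e).factorial : ℝ) ≤ 2 ^ (d + e) * (d.factorial * e.factorial) := by
    have h4 := Nat.add_choose_mul_factorial_mul_factorial d e
    have h5 := Nat.choose_le_two_pow (d + e) e
    rw [mul_assoc] at h4
    have h6 := Nat.mul_le_mul_right (d.factorial * e.factorial) h5
    rw [h4] at h6
    exact_mod_cast h6
  have h4 := Real.logb_le_logb_of_le (b := 2) (by norm_num) (by positivity) h3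
  rw [Real.logb_mul (by positivity) (by positivity), Real.logb_mul (by positivity) (by positivity),
    Real.logb_pow, Real.logb_self_eq_one (by norm_num)] at h4
  push_cast at h4 ⊢
  linarith

theorem sum_le_of_targets {n : ℕ} (hn : 0 < n) {T : Set ℕ} {y : ℕ → ℕ}
    (hy : ∀ k < n, y k = 0 ∨ ∃ t ∈ T, max 1 (Nat.dist (k + 1) t) * 2 ^ y k ≤ n) {a b : ℕ} (u : ℕ)
    (hab : a ≤ b) (hbn : b ≤ n) (hTb : ∀ t ∈ T, t ≤ a ∨ t = u ∨ b ≤ t) :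
    ∑ k ∈ Finset.Ico a b, (y k : ℝ) ≤ ((b - a : ℕ) : ℝ) * Real.logb 2 n -
      Real.logb 2 ((b - a).factorial : ℝ) + 4 * ((b - a : ℕ) : ℝ) := by
  have hmul : ∀ k m, k < n → m ≤ n → (∀ t ∈ T, m ≤ max 1 (Nat.dist (k + 1) t)) →
      m * 2 ^ y k ≤ n := by
    intro k m hk hm h
    rcases hy k hk with h0 | ⟨t, ht, h1⟩
    · simpa [h0] using hm
    · exact (Nat.mul_le_mul_right _ (h t ht)).trans h1
  -- The extra target is clamped to `[a, b]`; if it lies outside, one of the two parts is empty.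
  refine sum_le_of_split_gap (u := max a (min u b)) (by omega) (by omega) ?_ ?_
  · intro k h1 h2
    refine hmul k _ (by omega) (by omega) fun t ht => ?_
    have := hTb t ht
    unfold Nat.dist
    omega
  · intro k h1 h2
    refine hmul k _ (by omega) (by omega) fun t ht => ?_
    have := hTb t ht
    unfold Nat.dist
    omega

/-- Induction along the sorted positions. The number `u` is the last occurrence belonging to the
position before the current gap. By `hpair`, it either does not exceed the next position or is also
the last occurrence for that position, so it is the only target that can lie strictly inside the
gap. -/
theorem sum_le_of_gaps {n : ℕ} (hn : 0 < n) {T : Set ℕ} {y last : ℕ → ℕ}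
    (hy : ∀ k < n, y k = 0 ∨ ∃ t ∈ T, max 1 (Nat.dist (k + 1) t) * 2 ^ y k ≤ n) (l : List ℕ)
    (a u : ℕ) (hsort : (a :: l).Pairwise (· ≤ ·)) (hle : ∀ s ∈ a :: l, s ≤ n)
    (hlast : ∀ s ∈ l, s ≤ last s)
    (hpair : l.Pairwise fun s s' => last s ≤ s' ∨ last s = last s')
    (hu : ∀ s ∈ l, u ≤ s ∨ u = last s)
    (hT : ∀ t ∈ T, t ≤ a ∨ t = u ∨ ∃ s ∈ l, t = s ∨ t = last s) :
    ∑ k ∈ Finset.Ico a n, (y k : ℝ) ≤ ((n - a : ℕ) : ℝ) * Real.logb 2 n -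
      ((List.zipWith (fun a b => b - a) (a :: l) (l ++ [n])).map
        fun d => Real.logb 2 (d.factorial : ℝ)).sum + 4 * ((n - a : ℕ) : ℝ) := by
  induction l generalizing a u with
  | nil =>
    have := sum_le_of_targets hn hy u (hle a (by simp)) le_rfl fun t ht => by
      rcases hT t ht with h | h | ⟨s, hs, -⟩
      · exact .inl h
      · exact .inr (.inl h)
      · simp at hs
    simpa using this
  | cons b l ih =>
    rw [List.pairwise_cons] at hsort hpair
    have hbl := List.pairwise_cons.1 hsort.2
    have hab : a ≤ b := hsort.1 b (by simp)
    have hbn : b ≤ n := hle b (by simp)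
    have h1 := sum_le_of_targets hn hy u hab hbn fun t ht => by
      rcases hT t ht with h | h | ⟨s, hs, h⟩
      · exact .inl h
      · exact .inr (.inl h)
      · have h2 : b ≤ s := by
          rcases List.mem_cons.1 hs with rfl | hs
          · exact le_rfl
          · exact hbl.1 s hs
        have h3 := hlast s hs
        omega
    have hT' : ∀ t ∈ T, t ≤ b ∨ t = last b ∨ ∃ s ∈ l, t = s ∨ t = last s := by
      intro t ht
      rcases hT t ht with h | h | ⟨s, hs, h⟩
      · exact .inl (by omega)
      · have := hu b (by simp)
        omega
      · rcases List.mem_cons.1 hs with rfl | hs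
        · omega
        · exact .inr (.inr ⟨s, hs, h⟩)
    have h2 := ih b (last b) hsort.2 (fun s hs => hle s (by simp [List.mem_cons.1 hs]))
      (fun s hs => hlast s (by simp [hs])) hpair.2 (fun s hs => hpair.1 s hs) hT'
    rw [← Finset.sum_Ico_consecutive _ hab hbn]
    simp only [List.cons_append, List.zipWith_cons_cons, List.map_cons, List.sum_cons] at h2 ⊢
    rw [Nat.cast_sub hab] at h1
    rw [Nat.cast_sub hbn] at h2
    rw [Nat.cast_sub (hab.trans hbn)]
    linarith

/-! ### Last positions and the bound for the whole array -/

section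

variable {α : Type*} [LinearOrder α] {A : List α}

theorem searchPos_le (A : List α) (a : α) : searchPos A a ≤ A.length := by
  unfold searchPos
  split
  · rename_i h
    exact ((countP_lt_countP_iff A a).2 h).trans_le List.countP_le_length
  · exact List.countP_le_length

theorem queriesFrom_le (ops : List (Op α)) {L : List (Entry α)} (hL : ∀ e ∈ L, e.pos ≤ A.length) :
    ∀ q ∈ queriesFrom A L ops, q ≤ A.length := by
  induction ops generalizing L with
  | nil => simp [queriesFrom]
  | cons o ops ih =>
    intro q hq
    rcases List.mem_append.1 hq with hq | hq
    · cases o with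
      | select i =>
        obtain ⟨e, he, rfl⟩ := List.mem_map.1 hq
        exact hL e (List.mem_of_getElem? (Option.mem_toList.1 he))
      | search a =>
        rw [List.mem_singleton.1 hq]
        exact searchPos_le A a
      | insert a => simp [queryPos] at hq
      | delete i => simp [queryPos] at hq
    · refine ih ?_ q hq
      cases o with
      | select i => exact hL
      | search a => exact hL
      | insert a =>
        intro e he
        rcases List.mem_append.1 he with he | he
        · exact hL e ((List.takeWhile_sublist _).subset he)
        rcases List.mem_cons.1 he with rfl | he
        · exact searchPos_le A a
        · exact hL e ((List.dropWhile_sublist _).subset he)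
      | delete i => exact fun e he => hL e ((List.eraseIdx_sublist _ _).subset he)

theorem queries_le (A : List α) (ops : List (Op α)) : ∀ q ∈ queries A ops, q ≤ A.length := by
  refine queriesFrom_le ops fun e he => ?_
  obtain ⟨x, hx, rfl⟩ := List.mem_map.1 he
  have := List.snd_lt_of_mem_zipIdx hx
  rw [List.length_insertionSort] at this
  simp only
  omega

theorem le_lastPos (A : List α) (s : ℕ) : s ≤ lastPos A s := by
  unfold lastPos
  split
  · rename_i x hx
    have := (sorted_iff_lt_countP (le_closed x) hx).1 (by simp)
    omega
  · exact le_rfl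

/-- Equal elements at the two positions share their last occurrence; otherwise all occurrences of
the first come before `s'`. Position `0` is treated like position `1`, since `s - 1` truncates. -/
theorem lastPos_le_or_eq {s s' : ℕ} (h : s ≤ s') (hs' : s' ≤ A.length) :
    lastPos A s ≤ s' ∨ lastPos A s = lastPos A s' := by
  rcases h.eq_or_lt with rfl | h
  · exact .inr rfl
  have h1 : s - 1 < (A.insertionSort (· ≤ ·)).length := by
    rw [List.length_insertionSort]; omega
  have h2 : s' - 1 < (A.insertionSort (· ≤ ·)).length := by
    rw [List.length_insertionSort]; omega
  have e1 := List.getElem?_eq_getElem h1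
  have e2 := List.getElem?_eq_getElem h2
  unfold lastPos
  rw [e1, e2]
  simp only
  generalize (A.insertionSort (· ≤ ·))[s - 1] = x at *
  generalize (A.insertionSort (· ≤ ·))[s' - 1] = x' at *
  rcases lt_or_ge x x' with hx | hx
  · left
    have h3 := (sorted_iff_lt_countP (le_closed x) e2).not
    simp only [decide_eq_true_eq, not_le] at h3
    have := h3.1 hx
    omega
  · right
    have h3 := (sorted_iff_lt_countP (le_closed x') e2).1 (by simp)
    have h4 := (sorted_iff_lt_countP (le_closed x') e1).2 (by omega)
    rw [decide_eq_true_eq] at h4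
    rw [le_antisymm h4 hx]

theorem sum_le_infoBound (hn : 0 < A.length) {S : List ℕ} (hS : ∀ q ∈ S, q ≤ A.length)
    {y : ℕ → ℕ} (hy : ∀ k < A.length,
      y k = 0 ∨ ∃ t ∈ targets A S, max 1 (Nat.dist (k + 1) t) * 2 ^ y k ≤ A.length) :
    ∑ k ∈ Finset.range A.length, (y k : ℝ) ≤ infoBound A.length S + 6 * A.length := by
  have hmem : ∀ s, s ∈ S.insertionSort (· ≤ ·) ↔ s ∈ S := fun s => List.mem_insertionSort _
  have h := sum_le_of_gaps hn (last := lastPos A) hy (S.insertionSort (· ≤ ·)) 0 0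
    (List.pairwise_cons.2 ⟨fun _ _ => Nat.zero_le _, pairwise_sorted S⟩)
    (by
      intro s hs
      rcases List.mem_cons.1 hs with rfl | hs
      · exact Nat.zero_le _
      · exact hS s ((hmem s).1 hs))
    (fun s _ => le_lastPos A s)
    ((pairwise_sorted S).imp_of_mem fun _ hb hab => lastPos_le_or_eq hab (hS _ ((hmem _).1 hb)))
    (fun _ _ => .inl (Nat.zero_le _))
    (by
      rintro t (ht | ⟨s, hs, rfl⟩)
      · exact .inr (.inr ⟨t, (hmem t).2 ht, .inl rfl⟩)
      · exact .inr (.inr ⟨s, (hmem s).2 hs, .inr rfl⟩))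
  -- Replacing `n log n` by `log n!` costs `2 n`, which with the `4 n` from the gaps gives `6 n`.
  have h2 := mul_logb_two_le A.length
  rw [Finset.range_eq_Ico]
  unfold infoBound gaps
  rw [Nat.sub_zero] at h
  linarith

end

/-! ### The total cost -/

theorem weight_succ (j : ℕ) : weight (j + 1) = depth j + 460 * (j + 1) := by
  induction j with
  | zero => rfl
  | succ j ih =>
    rw [weight, ih, depth]
    ring

theorem sq_le_two_mul_depth (j : ℕ) : j * j ≤ 2 * depth j := by
  induction j with
  | zero => simp
  | succ j ih =>
    rw [depth]
    nlinarith

/-- A charge controls the depth of the parent only, hence `depth (j - 1)`. The rest is `460 * j`,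
which is `O(√depth)` because `depth` is quadratic. -/
theorem weight_le (j : ℕ) :
    (weight j : ℝ) ≤ depth (j - 1) + 920 * √(depth (j - 1) : ℝ) + 460 := by
  rcases j with _ | j
  · simp [weight, depth]
  rw [weight_succ, Nat.add_sub_cancel]
  have h1 : (j : ℝ) ≤ 2 * √(depth j : ℝ) := by
    have h2 : (j : ℝ) * j ≤ 2 * depth j := by exact_mod_cast sq_le_two_mul_depth j
    have h3 := Real.sq_sqrt (Nat.cast_nonneg (α := ℝ) (depth j))
    have h4 := Real.sqrt_nonneg (depth j : ℝ)
    nlinarith [Nat.cast_nonneg (α := ℝ) (depth j)]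
  push_cast
  linarith

theorem sum_map_eq_sum_range (f : ℕ → ℕ) (l : List ℕ) :
    (l.map f).sum = ∑ k ∈ Finset.range l.length, f (l.getD k 0) := by
  induction l with
  | nil => rfl
  | cons x l ih =>
    rw [List.map_cons, List.sum_cons, ih, List.length_cons, Finset.sum_range_succ', add_comm]
    simp

theorem sum_sqrt_le (n : ℕ) (y : ℕ → ℕ) :
    ∑ k ∈ Finset.range n, √(y k : ℝ) ≤ √(n * ∑ k ∈ Finset.range n, (y k : ℝ)) := by
  apply Real.le_sqrt_of_sq_le
  have h := sq_sum_le_card_mul_sum_sq (s := Finset.range n) (f := fun k => √(y k : ℝ))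
  rw [Finset.card_range] at h
  refine h.trans_eq ?_
  congr 1
  exact Finset.sum_congr rfl fun k _ => Real.sq_sqrt (Nat.cast_nonneg _)

/-- The relative excess over the information-theoretic bound. -/
noncomputable def excess (x : ℝ) : ℝ := 2760 / √(max 1 x)

theorem tendsto_excess : Filter.Tendsto excess Filter.atTop (nhds 0) := by
  refine Filter.Tendsto.div_atTop tendsto_const_nhds (Real.tendsto_sqrt_atTop.comp ?_)
  exact Filter.tendsto_atTop_mono (fun x => le_max_right 1 x) Filter.tendsto_id

theorem excess_le (x : ℝ) : excess x ≤ 2760 := by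
  unfold excess
  exact div_le_self (by norm_num) (Real.one_le_sqrt.2 (le_max_left _ _))

/-- If `B ≥ n` then `Y ≤ 7 * B` and `√(n * Y) ≤ 3 * n * √(B / n)`; the constant in `excess` is `2760
= 3 * 920`. If `B ≤ n`, everything is linear in `n`. -/
theorem add_sqrt_le_excess {n Y B : ℝ} (hn : 0 < n) (hY : 0 ≤ Y) (hYB : Y ≤ B + 6 * n) :
    Y + 920 * √(n * Y) ≤ B * (1 + excess (B / n)) + 20000 * n := by
  rcases le_total n B with h | h
  · have hx : 1 ≤ B / n := (one_le_div hn).2 h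
    have h1 : √(n * Y) ≤ 3 * (n * √(B / n)) := by
      rw [Real.sqrt_le_left (by positivity)]
      have h2 : (3 * (n * √(B / n))) ^ 2 = 9 * (n * B) := by
        rw [mul_pow, mul_pow, Real.sq_sqrt (by positivity)]
        field_simp
        ring
      rw [h2]
      nlinarith
    have h3 : B * excess (B / n) = 2760 * (n * √(B / n)) := by
      unfold excess
      rw [max_eq_right hx]
      have h4 : 0 < √(B / n) := Real.sqrt_pos.2 (by linarith)
      have h5 : B = n * (√(B / n) * √(B / n)) := by
        rw [Real.mul_self_sqrt (by linarith)]
        field_simp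
      field_simp
      rw [sq, ← h5]
    rw [mul_add, h3]
    linarith
  -- The sign of `B` is not known here, only `B ≥ -6 * n`; the constant `20000` absorbs `2760 * B`
  -- in that case.
  · have hx : B / n ≤ 1 := (div_le_one hn).2 h
    have h1 : √(n * Y) ≤ 3 * n := by
      rw [Real.sqrt_le_left (by positivity)]
      nlinarith
    have h2 : excess (B / n) = 2760 := by
      unfold excess
      rw [max_eq_left hx]
      simp
    rw [h2]
    linarith

section

variable {α : Type*} [LinearOrder α] {A : List α}

theorem potential_le (hn : 0 < A.length) {S : List ℕ} (hS : ∀ q ∈ S, q ≤ A.length)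
    {bs : List Bucket} (h : Partition (val A) A.length (targets A S) bs) :
    (potential bs : ℝ) ≤ infoBound A.length S * (1 + excess (infoBound A.length S / A.length)) +
      20460 * A.length := by
  have hlen : (levels bs).length = A.length := by rw [length_levels, h.total_eq]
  -- The depth of the parent bucket, which is what `charged` bounds; for level `0` it is `0`.
  set y : ℕ → ℕ := fun k => depth ((levels bs).getD k 0 - 1) with hydef
  have hy : ∀ k < A.length,
      y k = 0 ∨ ∃ t ∈ targets A S, max 1 (Nat.dist (k + 1) t) * 2 ^ y k ≤ A.length := by
    intro k hk
    have hk' : k < (levels bs).length := by omega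
    rcases hj : (levels bs)[k] with _ | j
    · left
      simp [hydef, hk', hj, depth]
    · right
      have := h.charged k j (by rw [List.getElem?_eq_getElem hk', hj])
      simpa [hydef, hk', hj] using this
  have hsum := sum_le_infoBound hn hS hy
  have hpot : (potential bs : ℝ) =
      ∑ k ∈ Finset.range A.length, (weight ((levels bs).getD k 0) : ℝ) := by
    rw [← hlen, potential, ← Nat.cast_sum]
    congr 1
    exact sum_map_eq_sum_range weight _
  have hle : (potential bs : ℝ) ≤ ∑ k ∈ Finset.range A.length, (y k : ℝ) +
      920 * √(A.length * ∑ k ∈ Finset.range A.length, (y k : ℝ)) + 460 * A.length := by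
    rw [hpot]
    refine (Finset.sum_le_sum fun k _ => weight_le ((levels bs).getD k 0)).trans ?_
    rw [Finset.sum_add_distrib, Finset.sum_add_distrib, ← Finset.mul_sum, Finset.sum_const,
      Finset.card_range, nsmul_eq_mul]
    have := sum_sqrt_le A.length y
    simp only [hydef] at this ⊢
    linarith
  have := add_sqrt_le_excess (n := A.length) (by exact_mod_cast hn)
    (Finset.sum_nonneg fun k _ => Nat.cast_nonneg (y k)) hsum
  linarith

end

theorem size_mul_le (a b : ℕ) : (a * b).size ≤ a.size + b.size := by
  rw [Nat.size_le, pow_add]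
  exact Nat.mul_lt_mul'' (Nat.lt_size_self a) (Nat.lt_size_self b)

theorem size_le_logb {n : ℕ} (hn : 0 < n) : (n.size : ℝ) ≤ Real.logb 2 n + 1 := by
  have h0 : 0 < n.size := Nat.size_pos.2 hn
  have h1 : 2 ^ (n.size - 1) ≤ n := Nat.lt_size.1 (by omega)
  have h2 : ((2 : ℝ) ^ (n.size - 1)) ≤ n := by exact_mod_cast h1
  have h3 := Real.logb_le_logb_of_le (b := 2) (by norm_num) (by positivity) h2
  rw [Real.logb_pow, Real.logb_self_eq_one (by norm_num), Nat.cast_sub h0] at h3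
  push_cast at h3
  linarith

end DynMultiselect

/-! ### The main theorem -/

theorem mainTheorem2 :
    ∃ D : OnlineStructure,
      (∀ (α : Type u) [LinearOrder α] (A : List α) (ops : List (Op α)),
        Valid A ops → D.answers A ops = expectedAnswers A ops) ∧
      ∃ δ : ℝ → ℝ, Filter.Tendsto δ Filter.atTop (nhds 0) ∧ BddAbove (Set.range δ) ∧
        ∀ C : ℕ, ∃ K : ℝ, ∀ (α : Type u) [LinearOrder α] (A : List α) (ops : List (Op α)),
          Valid A ops → ops.length ≤ C * A.length →
          (D.cost A ops : ℝ) ≤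
            infoBound A.length (queries A ops) *
                (1 + δ (infoBound A.length (queries A ops) / A.length)) +
              K * (A.length + ops.countP Op.nonSelect * Real.logb 2 A.length) := by
  refine ⟨multiselect, fun α _ A ops h => (multiselect_run A ops h).1, excess, tendsto_excess,
    ⟨2760, by rintro _ ⟨x, rfl⟩; exact excess_le x⟩, fun C => ?_⟩
  -- Each non-selection costs at most `12 * log n + 20 + 2 * C.size`. The constant part is
  -- multiplied by at most `C * n` operations and goes into the linear term; `20473 = 20460 + 1 +
  -- 12` adds the potential, the preprocessing and the factor of `log n`.
  refine ⟨20473 + C * (20 + 2 * C.size), fun α _ A ops h hlen => ?_⟩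
  obtain ⟨-, bs, hbs, hcost⟩ := multiselect_run A ops h
  rcases Nat.eq_zero_or_pos A.length with h0 | hn
  · have hops : ops = [] := by simpa [h0] using hlen
    have hlev : levels bs = [] := by
      rw [← List.length_eq_zero_iff, length_levels, hbs.total_eq, h0]
    have hzero : multiselect.cost A ops = 0 := by
      simpa [h0, hops, potential, hlev] using hcost
    rw [hzero, h0, hops]
    simp [queries, queriesFrom, infoBound, gaps]
  have hpot := potential_le hn (queries_le A ops) hbs
  have hsize : ops.length.size ≤ C.size + A.length.size :=
    (Nat.size_le_size hlen).trans (size_mul_le _ _)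
  have hlog := size_le_logb hn
  have hlog0 : 0 ≤ Real.logb 2 (A.length : ℝ) :=
    Real.logb_nonneg (by norm_num) (by exact_mod_cast hn)
  have hq : ops.countP Op.nonSelect ≤ C * A.length := List.countP_le_length.trans hlen
  have hcost' : (multiselect.cost A ops : ℝ) ≤ A.length + potential bs +
      ops.countP Op.nonSelect * (10 * A.length.size + 8 + 2 * ops.length.size) := by
    exact_mod_cast hcost
  have hsize' : (ops.length.size : ℝ) ≤ C.size + A.length.size := by exact_mod_cast hsize
  have hq' : (ops.countP Op.nonSelect : ℝ) ≤ C * A.length := by exact_mod_cast hq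
  have hq0 : (0 : ℝ) ≤ ops.countP Op.nonSelect := Nat.cast_nonneg _
  generalize (ops.countP Op.nonSelect : ℝ) = q at *
  have h1 : q * (10 * A.length.size + 8 + 2 * ops.length.size) ≤
      q * (12 * Real.logb 2 A.length + (20 + 2 * C.size)) :=
    mul_le_mul_of_nonneg_left (by linarith) hq0
  have h2 : q * (20 + 2 * C.size) ≤ C * A.length * (20 + 2 * C.size) :=
    mul_le_mul_of_nonneg_right hq' (by positivity)
  have h3 : 0 ≤ (20461 + C * (20 + 2 * C.size) : ℝ) * (q * Real.logb 2 A.length) := by positivity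
  have h4 : (0 : ℝ) ≤ A.length := Nat.cast_nonneg _
  linarith
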